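/- Let $1\le k<n$ be integers and let $m>0$, $A$, $\mu>0$, $B$ be real numbers. There is a constant $C>0$, depending only on $n,k,m,A,\mu,B$, with the following property. Let $h:\mathbb S^n\to\mathbb R$ be smooth and convex, i.e. $\nabla^2h+hI\ge 0$ on $\mathbb S^n$, where $\nabla h$ and $\nabla^2h$ are the gradient and the covariant Hessian with respect to the round metric of the unit sphere $\mathbb S^n\subset\mathbb R^{n+1}$, and let $f=f(x,z,p)$ be a real function of class $C^2$ of $x\in\mathbb S^n$, $z>0$, $p\in T_x\mathbb S^n$. Suppose that $$\sigma_k(\nabla^2h+hI)=f(x,h,\nabla h)\quad\text{on }\mathbb S^n,$$ where $\sigma_k$ is the $k$-th elementary symmetric function of the eigenvalues, and that on $\mathbb S^n$ $$h\ge m,\qquad |h|+|\nabla h|\le A,\qquad f(x,h,\nabla h)\ge\mu,$$ and that the values and the first and second derivatives of $f$, in all its arguments $(x,z,p)$, have norm at most $B$ at the points $(x,h(x),\nabla h(x))$, $x\in\mathbb S^n$. (Derivatives of $f$ are taken as Euclidean derivatives of the extension $(y,z,q)\mapsto f\big(\tfrac{y}{|y|},z,q-\langle q,\tfrac{y}{|y|}\rangle\tfrac{y}{|y|}\big)$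 of $f$ to $(\mathbb R^{n+1}\setminus\{0\})\times(0,\infty)\times\mathbb R^{n+1}$.) Then $$\Delta h+nh\le C\quad\text{on }\mathbb S^n .$$ -/

import Mathlib

open scoped ContDiff Manifold RealInnerProductSpace

noncomputable section

namespace SphereHessian

/-- The Euclidean space `ℝⁿ⁺¹`. -/
abbrev Euc (n : ℕ) : Type := EuclideanSpace ℝ (Fin (n + 1))

/-- The unit sphere `𝕊ⁿ` in `ℝⁿ⁺¹`, with Mathlib's smooth structure. -/
abbrev Sph (n : ℕ) : Type := Metric.sphere (0 : Euc n) 1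

/-- The tangent space `T_x 𝕊ⁿ = x^⊥`, with the inner product inherited from `ℝⁿ⁺¹`
(that is, the round metric). -/
abbrev Tan {n : ℕ} (x : Sph n) : Submodule ℝ (Euc n) := (ℝ ∙ (x : Euc n))ᗮ

/-- The radial retraction `y ↦ y / |y|` of `ℝⁿ⁺¹ ∖ {0}` onto `𝕊ⁿ`
(with a dummy value at `0`, which plays no role). -/
def retract {n : ℕ} (y : Euc n) : Sph n :=
  if hy : y = 0 then ⟨EuclideanSpace.single 0 1, by simp⟩
  else ⟨‖y‖⁻¹ • y, by
    rw [mem_sphere_zero_iff_norm, norm_smul, norm_inv, norm_norm,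
      inv_mul_cancel₀ (norm_ne_zero_iff.mpr hy)]⟩

theorem retract_coe {n : ℕ} (x : Sph n) : retract (x : Euc n) = x := by
  have hx : ‖(x : Euc n)‖ = 1 := mem_sphere_zero_iff_norm.mp x.2
  have h0 : (x : Euc n) ≠ 0 := by
    intro h
    rw [h, norm_zero] at hx
    exact zero_ne_one hx
  apply Subtype.ext
  simp [retract, h0, hx]

/-- The extension of a function on `𝕊ⁿ` to `ℝⁿ⁺¹ ∖ {0}` that is constant along rays. -/
def radialExt {n : ℕ} (h : Sph n → ℝ) (y : Euc n) : ℝ := h (retract y)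

/-- The spherical gradient `∇h(x) ∈ T_x 𝕊ⁿ`: the tangential part of the Euclidean gradient of
an extension of `h`. -/
def sphGrad {n : ℕ} (h : Sph n → ℝ) (x : Sph n) : Tan x :=
  (Tan x).orthogonalProjectionOnto (gradient (radialExt h) (x : Euc n))

/-- The spherical (covariant) Hessian `∇²h(x)` as an endomorphism of `T_x 𝕊ⁿ`:
`u ↦ ∇_u ∇h`, the Levi-Civita derivative of the gradient field. The Levi-Civita connection of
the sphere is the tangential part of the Euclidean derivative; and since `radialExt h` is
constant along rays, its Euclidean gradient is tangential on the sphere, so that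
`gradient (radialExt h)` is an extension of the vector field `∇h`. -/
def sphHess {n : ℕ} (h : Sph n → ℝ) (x : Sph n) : Tan x →ₗ[ℝ] Tan x :=
  ((Tan x).orthogonalProjectionOnto ∘L fderiv ℝ (gradient (radialExt h)) (x : Euc n) ∘L
    (Tan x).subtypeL : Tan x →L[ℝ] Tan x)

/-- The spherical Laplacian `Δh`, the trace of the Hessian. -/
def sphLaplacian {n : ℕ} (h : Sph n → ℝ) (x : Sph n) : ℝ :=
  LinearMap.trace ℝ (Tan x) (sphHess h x)

/-- The endomorphism `b[h] = ∇²h + h I` of `T_x 𝕊ⁿ`. -/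
def radiiMap {n : ℕ} (h : Sph n → ℝ) (x : Sph n) : Tan x →ₗ[ℝ] Tan x :=
  sphHess h x + h x • LinearMap.id

/-- `σ_k(A)`: the `k`-th elementary symmetric function of the eigenvalues of `A`, counted with
multiplicity (the real roots of the characteristic polynomial; for a self-adjoint `A` these
are all of them). -/
def sigma {V : Type*} [AddCommGroup V] [Module ℝ V] [Module.Free ℝ V] [Module.Finite ℝ V]
    (k : ℕ) (A : V →ₗ[ℝ] V) : ℝ :=
  A.charpoly.roots.esymm k

/-- `h` is (spherically) convex: `∇²h + h I` is positive semidefinite at every point. -/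
def SphConvex {n : ℕ} (h : Sph n → ℝ) : Prop :=
  ∀ (x : Sph n) (u : Tan x), 0 ≤ ⟪radiiMap h x u, u⟫

/-- The extension of a function `f(x, z, p)` of `x ∈ 𝕊ⁿ`, `z ∈ ℝ`, `p ∈ T_x 𝕊ⁿ` to
`(y, z, q) ∈ (ℝⁿ⁺¹ ∖ {0}) × ℝ × ℝⁿ⁺¹`: replace `y` by `x = y / |y|` and `q` by its orthogonal
projection onto `T_x 𝕊ⁿ`. -/
def bundleExt {n : ℕ} (f : (x : Sph n) → ℝ → Tan x → ℝ) (w : Euc n × ℝ × Euc n) : ℝ :=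
  f (retract w.1) w.2.1 ((Tan (retract w.1)).orthogonalProjectionOnto w.2.2)

theorem bundleExt_coe {n : ℕ} (f : (x : Sph n) → ℝ → Tan x → ℝ) (x : Sph n) (z : ℝ)
    (p : Tan x) : bundleExt f ((x : Euc n), z, (p : Euc n)) = f x z p := by
  have key : ∀ x' : Sph n, x' = x →
      f x' z ((Tan x').orthogonalProjectionOnto (p : Euc n)) = f x z p := by
    rintro _ rfl
    rw [Submodule.orthogonalProjectionOnto_mem_subspace_eq_self]
  exact key _ (retract_coe x)

/-- `f(x, z, p)` is of class `C²` on `{(x, z, p) : x ∈ 𝕊ⁿ, z > 0, p ∈ T_x 𝕊ⁿ}`. The extension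
`bundleExt f` is the composition of `f` with a smooth retraction onto this submanifold, so that
it is `C²` exactly when `f` is. -/
def IsC2 {n : ℕ} (f : (x : Sph n) → ℝ → Tan x → ℝ) : Prop :=
  ContDiffOn ℝ 2 (bundleExt f) {w | w.1 ≠ 0 ∧ 0 < w.2.1}

/-- `f` and its derivatives of order one and two, in all the arguments, are bounded by `B` at
the points `(x, h(x), ∇h(x))`, `x ∈ 𝕊ⁿ`. -/
def C2BoundAlong {n : ℕ} (f : (x : Sph n) → ℝ → Tan x → ℝ) (h : Sph n → ℝ) (B : ℝ) : Prop :=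
  ∀ x : Sph n, ∀ j ≤ 2,
    ‖iteratedFDeriv ℝ j (bundleExt f) ((x : Euc n), h x, (sphGrad h x : Euc n))‖ ≤ B

end SphereHessian

end

/-!
Let `u` be the extension of `h` to a function on `ℝⁿ⁺¹ ∖ {0}` that is positively homogeneous of
degree one. At a point of the sphere, the Hessian `D²u` vanishes on the radial direction and is
`∇²h + h I` on the tangent space. So `σ_k(∇²h + h I)` is the sum of the principal `k × k` minors of
`D²u` (`sigma_radiiMap`), and the equation becomes an equation on a punctured Euclidean space,
`σ_k(D²u)(y) = |y|⁻ᵏ f(y, |y|⁻¹ u, Du - |y|⁻² u y)` (`minorSum_hessB_homExt`). All covariant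
derivatives are thereby replaced by commuting directional derivatives.

For `k = 1` the equation itself is the bound. For `k ≥ 2` the bound comes from the maximum
principle. Maximise `|D²u(x) e|² exp(N |Du(x)|²)` over all points and directions
(`exists_max_eigenvector`). At the maximum, `e` may be taken to be an eigenvector of `D²u`, for the
largest eigenvalue `λ`. With `e` *fixed*, half the logarithm of this quantity, made homogeneous of
degree `0` by the term `log |y|`, has a local maximum on the whole punctured space (`testFn`). Using
`|D²u e|` instead of `⟨D²u e, e⟩` makes a fixed direction sufficient even if `λ` is a multiple
eigenvalue.

Apply the linearised operator `∑ σⱼⱼ ∂ⱼ∂ⱼ`, `σⱼⱼ = ∂σ_k/∂λⱼ`, to the test function, and use the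
equation differentiated twice along `e` and once along `Du` (`equation_derivatives`).

* The gradient part of the test function produces the good term `N ∑ σⱼⱼ λⱼ² ≥ N λ μ / 2`: since
  `σ_k` is bounded, `λ σₐₐ` differs little from `σ_k ≥ μ` when `λ` is large (`es_erase_le`).
* Third derivatives of `u` also enter through the dependence of `f` on the gradient. These terms
  cancel by the first order condition at the maximum.
* The quadratic terms in third derivatives are bounded below by concavity of `log σ_k`, up to a
  small multiple of `σₐₐ (∂ₐ∂ₐ∂ₐu)²` (`third_order_estimate`, `third_order_terms_ge`). The first
  order condition gives `∂ₐ∂ₐ∂ₐu = -N λ² ∂ₐu`, so with the small factor `N⁻²` the remainder does not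
  grow with `N`.
* The term `log |y|` contributes `∑ σⱼⱼ (1 - 2 yⱼ²)`, `y` being the point; it is
  nonnegative because `k < n` (`sum_es_mul_one_sub_nonneg`).
* Everything else is at most a constant multiple of `λ`, the constant not depending on `N`, plus
  `N` times a constant.

For large `N` the good term absorbs the multiple of `λ`, so `λ` is bounded (`eigenvalue_le_of_max`,
`eigenvalue_le_of_isLocalMax`). The maximum property carries the bound to all points and directions
(`norm_homHess_le`), and so to the trace `Δh + n h` of `∇²h + h I`.

Concavity of `log σ_k` on the positive orthant rests on the superadditivity of `σ_{j+1} / σ_j`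
(`es_ratio_superadditive`), by induction on `j`.
-/


open scoped ContDiff Manifold RealInnerProductSpace

noncomputable section

namespace SphereHessian

open Finset Filter Topology

/-! ### Elementary symmetric functions and their log-concavity -/

/-- Superadditivity of the parallel sum `(x, y) ↦ x y / (x + y)`. -/
theorem parallel_sum_superadditive {a b c d : ℝ} (ha : 0 < a) (hb : 0 < b) (hc : 0 ≤ c)
    (hd : 0 ≤ d) :
    a * c / (a + c) + b * d / (b + d) ≤ (a + b) * (c + d) / ((a + b) + (c + d)) := by
  rw [div_add_div _ _ (by positivity) (by positivity), div_le_div_iff₀ (by positivity)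
    (by positivity)]
  nlinarith [sq_nonneg (a * d - b * c)]

theorem parallel_sum_mono {a c d : ℝ} (ha : 0 < a) (hc : 0 ≤ c) (hcd : c ≤ d) :
    a * c / (a + c) ≤ a * d / (a + d) := by
  rw [div_le_div_iff₀ (by linarith) (by linarith)]
  nlinarith [mul_nonneg (mul_nonneg ha.le ha.le) (sub_nonneg.2 hcd)]

section ElementarySymmetric

variable {ι : Type*}

/-- The elementary symmetric function of degree `j` of the numbers `l i`, `i ∈ s`. -/
def es (l : ι → ℝ) (j : ℕ) (s : Finset ι) : ℝ :=
  ∑ t ∈ s.powersetCard j, ∏ i ∈ t, l i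

theorem es_zero (l : ι → ℝ) (s : Finset ι) : es l 0 s = 1 := by
  simp [es]

theorem es_nonneg {l : ι → ℝ} (hl : ∀ i, 0 ≤ l i) (j : ℕ) (s : Finset ι) : 0 ≤ es l j s :=
  sum_nonneg fun _ _ => prod_nonneg fun i _ => hl i

theorem es_pos {l : ι → ℝ} (hl : ∀ i, 0 < l i) {j : ℕ} {s : Finset ι} (h : j ≤ #s) :
    0 < es l j s :=
  sum_pos (fun _ _ => prod_pos fun i _ => hl i) (powersetCard_nonempty.2 h)

theorem es_smul (l : ι → ℝ) (c : ℝ) (j : ℕ) (s : Finset ι) :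
    es (fun i => c * l i) j s = c ^ j * es l j s := by
  unfold es
  rw [mul_sum]
  refine sum_congr rfl fun t ht => ?_
  rw [prod_mul_distrib, prod_const, (mem_powersetCard.1 ht).2]

theorem es_mono_set {l : ι → ℝ} (hl : ∀ i, 0 ≤ l i) (j : ℕ) {s t : Finset ι} (h : s ⊆ t) :
    es l j s ≤ es l j t :=
  sum_le_sum_of_subset_of_nonneg (powersetCard_mono h) fun _ _ _ => prod_nonneg fun i _ => hl i

variable [DecidableEq ι]

theorem es_insert (l : ι → ℝ) (j : ℕ) {s : Finset ι} {i : ι} (hi : i ∉ s) :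
    es l (j + 1) (insert i s) = l i * es l j s + es l (j + 1) s := by
  unfold es
  rw [powersetCard_succ_insert hi, sum_union, add_comm, sum_image]
  · congr 1
    rw [mul_sum]
    refine sum_congr rfl fun t ht => ?_
    rw [prod_insert fun h => hi ((mem_powersetCard.1 ht).1 h)]
  · intro t ht t' ht' h
    have h1 : i ∉ t := fun h => hi ((mem_powersetCard.1 ht).1 h)
    have h2 : i ∉ t' := fun h => hi ((mem_powersetCard.1 ht').1 h)
    rw [← erase_insert h1, ← erase_insert h2, h]
  · rw [disjoint_left]
    intro t ht ht'
    obtain ⟨t', -, rfl⟩ := mem_image.1 ht'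
    exact hi ((mem_powersetCard.1 ht).1 (mem_insert_self _ _))

theorem es_erase (l : ι → ℝ) (j : ℕ) {s : Finset ι} {i : ι} (hi : i ∈ s) :
    es l (j + 1) s = l i * es l j (s.erase i) + es l (j + 1) (s.erase i) := by
  conv_lhs => rw [← insert_erase hi]
  exact es_insert l j (notMem_erase i s)

/-- Summing over pairs `(i, t)` with `i ∈ t`, by the set `t` or by the set `t ∖ {i}`. -/
theorem sum_powersetCard_succ_sum (s : Finset ι) (j : ℕ) (φ : ι → Finset ι → ℝ) :
    ∑ t ∈ s.powersetCard (j + 1), ∑ i ∈ t, φ i (t.erase i) =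
      ∑ i ∈ s, ∑ r ∈ (s.erase i).powersetCard j, φ i r := by
  rw [sum_sigma', sum_sigma']
  refine sum_bij' (fun x _ => ⟨x.2, x.1.erase x.2⟩) (fun x _ => ⟨insert x.1 x.2, x.1⟩)
    ?_ ?_ ?_ ?_ ?_
  · rintro ⟨t, i⟩ h
    simp only [mem_sigma, mem_powersetCard] at h ⊢
    obtain ⟨⟨h1, h2⟩, h3⟩ := h
    exact ⟨h1 h3, erase_subset_erase _ h1, by rw [card_erase_of_mem h3, h2]; rfl⟩
  · rintro ⟨i, r⟩ h
    simp only [mem_sigma, mem_powersetCard] at h ⊢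
    obtain ⟨h1, h2, h3⟩ := h
    refine ⟨⟨insert_subset h1 (h2.trans (erase_subset _ _)), ?_⟩, mem_insert_self _ _⟩
    rw [card_insert_of_notMem fun h => notMem_erase i s (h2 h), h3]
  · rintro ⟨t, i⟩ h
    simp only [mem_sigma, mem_powersetCard] at h
    simp [insert_erase h.2]
  · rintro ⟨i, r⟩ h
    simp only [mem_sigma, mem_powersetCard] at h
    have : i ∉ r := fun h' => notMem_erase i s (h.2.1 h')
    simp [erase_insert this]
  · rintro ⟨t, i⟩ h
    rfl

/-- Euler's identity for the elementary symmetric functions. -/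
theorem sum_mul_es_erase (l : ι → ℝ) (j : ℕ) (s : Finset ι) :
    ∑ i ∈ s, l i * es l j (s.erase i) = (j + 1) * es l (j + 1) s := by
  have := sum_powersetCard_succ_sum s j fun i r => l i * ∏ a ∈ r, l a
  simp only [← mul_sum] at this
  unfold es
  rw [← this, mul_sum]
  refine sum_congr rfl fun t ht => ?_
  rw [sum_congr rfl fun i hi => mul_prod_erase t l hi, sum_const, (mem_powersetCard.1 ht).2]
  simp

theorem sum_es_erase (l : ι → ℝ) (j : ℕ) (s : Finset ι) :
    ∑ i ∈ s, es l j (s.erase i) = (#s - j : ℝ) * es l j s := by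
  cases j with
  | zero => simp [es_zero]
  | succ j =>
    have h1 : ∑ i ∈ s, es l (j + 1) (s.erase i) =
        ∑ i ∈ s, (es l (j + 1) s - l i * es l j (s.erase i)) :=
      sum_congr rfl fun i hi => by rw [es_erase l j hi]; ring
    rw [h1, sum_sub_distrib, sum_mul_es_erase]
    push_cast
    simp
    ring

/-- If `σ_{j+1}` of nonnegative numbers is bounded then it is controlled linearly by `σ_j`: the
least factor of each monomial of `σ_{j+1}` is bounded. -/
theorem es_succ_le {l : ι → ℝ} (hl : ∀ i, 0 ≤ l i) (j : ℕ) (s : Finset ι) {R : ℝ} (hR : 1 ≤ R)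
    (h : es l (j + 1) s ≤ R) : es l (j + 1) s ≤ 2 ^ #s * R * es l j s := by
  have hmon : ∀ t ∈ s.powersetCard (j + 1), ∏ i ∈ t, l i ≤ R * es l j s := by
    intro t ht
    obtain ⟨hts, hcard⟩ := mem_powersetCard.1 ht
    have hne : t.Nonempty := card_pos.1 (by omega)
    obtain ⟨i, hi, hmin⟩ := exists_min_image t l hne
    have h1 : l i ^ (j + 1) ≤ R := by
      calc l i ^ (j + 1) = ∏ _a ∈ t, l i := by rw [prod_const, hcard]
        _ ≤ ∏ a ∈ t, l a := prod_le_prod (fun _ _ => hl i) hmin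
        _ ≤ es l (j + 1) s :=
          single_le_sum (f := fun t => ∏ a ∈ t, l a) (fun _ _ => prod_nonneg fun i _ => hl i) ht
        _ ≤ R := h
    have h2 : l i ≤ R := by
      by_contra hc
      push Not at hc
      have : R ^ (j + 1) < l i ^ (j + 1) := pow_lt_pow_left₀ hc (by linarith) (by omega)
      have : R ≤ R ^ (j + 1) := le_self_pow₀ hR (by omega)
      linarith
    have h3 : ∏ a ∈ t.erase i, l a ≤ es l j s :=
      single_le_sum (f := fun t => ∏ a ∈ t, l a) (fun _ _ => prod_nonneg fun i _ => hl i)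
        (mem_powersetCard.2 ⟨(erase_subset _ _).trans hts, by
          rw [card_erase_of_mem hi, hcard]; rfl⟩)
    rw [← mul_prod_erase t l hi]
    exact mul_le_mul h2 h3 (prod_nonneg fun i _ => hl i) (by linarith)
  calc es l (j + 1) s ≤ ∑ _t ∈ s.powersetCard (j + 1), R * es l j s := sum_le_sum hmon
    _ = #(s.powersetCard (j + 1)) * (R * es l j s) := by rw [sum_const, nsmul_eq_mul]
    _ ≤ 2 ^ #s * (R * es l j s) := by
      refine mul_le_mul_of_nonneg_right ?_ (mul_nonneg (by linarith) (es_nonneg hl _ _))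
      have : #(s.powersetCard (j + 1)) ≤ 2 ^ #s := by
        rw [← card_powerset]
        exact card_le_card fun t ht => mem_powerset.2 (mem_powersetCard.1 ht).1
      exact_mod_cast this
    _ = _ := by ring

/-- The quotient `σ_{j+1} / σ_j` is an average of parallel sums of `l i` with the quotients
`σ_j / σ_{j-1}` of the other numbers. -/
theorem es_ratio_recursion {l : ι → ℝ} (hl : ∀ i, 0 < l i) (j : ℕ) {s : Finset ι}
    (h : j + 1 ≤ #s) :
    es l (j + 2) s / es l (j + 1) s = (j + 2 : ℝ)⁻¹ * ∑ i ∈ s,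
      l i * (es l (j + 1) (s.erase i) / es l j (s.erase i)) /
        (l i + es l (j + 1) (s.erase i) / es l j (s.erase i)) := by
  have h1 := sum_mul_es_erase l (j + 1) s
  have hp : 0 < es l (j + 1) s := es_pos hl h
  have h2 : ∀ i ∈ s, l i * (es l (j + 1) (s.erase i) / es l j (s.erase i)) /
        (l i + es l (j + 1) (s.erase i) / es l j (s.erase i)) =
      l i * es l (j + 1) (s.erase i) / es l (j + 1) s := by
    intro i hi
    have h3 : 0 < es l j (s.erase i) := es_pos hl (by rw [card_erase_of_mem hi]; omega)
    have h4 := es_erase l j hi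
    rw [div_eq_div_iff _ hp.ne']
    · rw [h4]
      field_simp
    · have := es_nonneg (fun i => (hl i).le) (j + 1) (s.erase i)
      have := hl i
      positivity
  rw [sum_congr rfl h2, ← sum_div, h1]
  push_cast
  field_simp
  ring

/-- The quotients `σ_{j+1} / σ_j` are superadditive on the positive orthant. -/
theorem es_ratio_superadditive {l l' : ι → ℝ} (hl : ∀ i, 0 < l i) (hl' : ∀ i, 0 < l' i) (j : ℕ) :
    ∀ s : Finset ι, j ≤ #s →
      es l (j + 1) s / es l j s + es l' (j + 1) s / es l' j s ≤
        es (l + l') (j + 1) s / es (l + l') j s := by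
  have hs : ∀ i, 0 < (l + l') i := fun i => add_pos (hl i) (hl' i)
  induction j with
  | zero =>
    intro s _
    have : ∀ m : ι → ℝ, es m 1 s = ∑ i ∈ s, m i := by
      intro m
      have := sum_mul_es_erase m 0 s
      simp only [es_zero] at this
      simpa using this.symm
    simp [es_zero, this, sum_add_distrib]
  | succ j ih =>
    intro s h
    rw [es_ratio_recursion hl j h, es_ratio_recursion hl' j h, es_ratio_recursion hs j h,
      ← mul_add, ← sum_add_distrib]
    refine mul_le_mul_of_nonneg_left (sum_le_sum fun i hi => ?_) (by positivity)
    have hc : j ≤ #(s.erase i) := by rw [card_erase_of_mem hi]; omega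
    have n1 : 0 ≤ es l (j + 1) (s.erase i) / es l j (s.erase i) :=
      div_nonneg (es_nonneg (fun i => (hl i).le) _ _) (es_nonneg (fun i => (hl i).le) _ _)
    have n2 : 0 ≤ es l' (j + 1) (s.erase i) / es l' j (s.erase i) :=
      div_nonneg (es_nonneg (fun i => (hl' i).le) _ _) (es_nonneg (fun i => (hl' i).le) _ _)
    exact (parallel_sum_superadditive (hl i) (hl' i) n1 n2).trans
      (parallel_sum_mono (hs i) (add_nonneg n1 n2) (ih _ hc))

/-- Midpoint log-concavity of `σ_j` on the positive orthant: by induction, each quotient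
`σ_{i+1} / σ_i` being concave, hence log-concave. -/
theorem es_mul_es_le {l l' : ι → ℝ} (hl : ∀ i, 0 < l i) (hl' : ∀ i, 0 < l' i) (s : Finset ι)
    (j : ℕ) (h : j ≤ #s) :
    es l j s * es l' j s ≤ es (fun i => 2⁻¹ * (l + l') i) j s ^ 2 := by
  set m : ι → ℝ := fun i => 2⁻¹ * (l + l') i with hm
  have hmp : ∀ i, 0 < m i := fun i => by
    have := hl i; have := hl' i; simp only [hm, Pi.add_apply]; positivity
  induction j with
  | zero => simp [es_zero]
  | succ j ih =>
    have ih := ih (by omega)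
    have p1 : 0 < es l j s := es_pos hl (by omega)
    have p2 : 0 < es l' j s := es_pos hl' (by omega)
    have p3 : 0 < es m j s := es_pos hmp (by omega)
    have q1 : 0 < es l (j + 1) s := es_pos hl h
    have q2 : 0 < es l' (j + 1) s := es_pos hl' h
    have q3 : 0 < es m (j + 1) s := es_pos hmp h
    have hsup := es_ratio_superadditive hl hl' j s (by omega)
    have hhom : es (l + l') (j + 1) s / es (l + l') j s = 2 * (es m (j + 1) s / es m j s) := by
      have p4 : 0 < es (l + l') j s := es_pos (fun i => add_pos (hl i) (hl' i)) (by omega)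
      rw [hm, es_smul, es_smul, pow_succ]
      field_simp
    rw [hhom] at hsup
    set x := es l (j + 1) s / es l j s with hx
    set y := es l' (j + 1) s / es l' j s with hy
    set z := es m (j + 1) s / es m j s with hz
    have hx0 : 0 < x := div_pos q1 p1
    have hy0 : 0 < y := div_pos q2 p2
    have hxy : x * y ≤ z ^ 2 := by nlinarith [sq_nonneg (x - y)]
    have e1 : es l (j + 1) s = x * es l j s := by rw [hx]; field_simp
    have e2 : es l' (j + 1) s = y * es l' j s := by rw [hy]; field_simp
    have e3 : es m (j + 1) s = z * es m j s := by rw [hz]; field_simp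
    rw [e1, e2, e3]
    calc x * es l j s * (y * es l' j s) = (x * y) * (es l j s * es l' j s) := by ring
      _ ≤ z ^ 2 * es m j s ^ 2 := mul_le_mul hxy ih (by positivity) (by positivity)
      _ = _ := by ring

end ElementarySymmetric

/-! ### Minors of matrices near a diagonal matrix -/

/-- The second order necessary condition at a local maximum on the line. -/
theorem deriv_zero_and_second_nonpos_of_isLocalMax {g g' : ℝ → ℝ} {c : ℝ}
    (h1 : ∀ᶠ t in 𝓝 (0 : ℝ), HasDerivAt g (g' t) t) (h2 : HasDerivAt g' c 0)
    (hmax : IsLocalMax g 0) : g' 0 = 0 ∧ c ≤ 0 := by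
  have h0 : g' 0 = 0 := hmax.hasDerivAt_eq_zero h1.self_of_nhds
  refine ⟨h0, ?_⟩
  by_contra hc
  push Not at hc
  have hd : deriv g =ᶠ[𝓝 0] g' := h1.mono fun t ht => ht.deriv
  have hdd : deriv (deriv g) 0 = c := by rw [hd.deriv_eq, h2.deriv]
  have hmin : IsLocalMin g 0 := isLocalMin_of_deriv_deriv_pos (by rw [hdd]; exact hc)
    (by rw [hd.self_of_nhds, h0]) h1.self_of_nhds.continuousAt
  -- a point which is both a local minimum and a local maximum has a locally constant function
  have hconst : g =ᶠ[𝓝 0] fun _ => g 0 := by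
    filter_upwards [hmin, hmax] with t ha hb using le_antisymm hb ha
  have hz : deriv g =ᶠ[𝓝 0] fun _ => 0 := by
    have := hconst.deriv
    filter_upwards [this] with t ht
    rw [ht, deriv_const]
  rw [hz.deriv_eq, deriv_const] at hdd
  linarith

section Minors

theorem perm_eq_one_of_fixes_compl {κ : Type*} [DecidableEq κ] {τ : Equiv.Perm κ} {i : κ}
    (h : ∀ l, l ≠ i → τ l = l) : τ = 1 := by
  ext l
  by_cases hl : l = i
  · subst hl
    by_contra hc
    exact hc (τ.injective (h _ hc))
  · exact h l hl

theorem perm_eq_one_or_swap_of_fixes_compl {κ : Type*} [DecidableEq κ] {τ : Equiv.Perm κ}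
    {i j : κ} (h : ∀ l, l ≠ i → l ≠ j → τ l = l) : τ = 1 ∨ τ = Equiv.swap i j := by
  by_cases hi : τ i = i
  · left
    refine perm_eq_one_of_fixes_compl (i := j) fun l hl => ?_
    by_cases hli : l = i
    · rw [hli, hi]
    · exact h l hli hl
  · right
    have hij : τ i = j := by
      by_contra hc
      exact hi (τ.injective (h _ hi hc))
    have h1 : Equiv.swap i j * τ = 1 := by
      refine perm_eq_one_of_fixes_compl (i := j) fun l hl => ?_
      by_cases hli : l = i
      · rw [hli, Equiv.Perm.mul_apply, hij, Equiv.swap_apply_right]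
      · rw [Equiv.Perm.mul_apply, h l hli hl, Equiv.swap_apply_of_ne_of_ne hli hl]
    have h2 := congrArg (fun σ => Equiv.swap i j * σ) h1
    simpa [← mul_assoc] using h2

variable {κ : Type*} [Fintype κ] [DecidableEq κ]

/-- In a Leibniz expansion with all columns but one diagonal, only the identity contributes. -/
theorem sum_perm_diagonal_erase (d : κ → ℝ) (i : κ) (c : κ → ℝ) :
    ∑ τ : Equiv.Perm κ, ((Equiv.Perm.sign τ : ℤ) : ℝ) *
      ((∏ l ∈ univ.erase i, Matrix.diagonal d (τ l) l) * c (τ i)) =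
      (∏ l ∈ univ.erase i, d l) * c i := by
  rw [sum_eq_single 1]
  · simp
  · intro τ _ hτ
    have : ∃ l, l ≠ i ∧ τ l ≠ l := by
      by_contra hc
      push Not at hc
      exact hτ (perm_eq_one_of_fixes_compl hc)
    obtain ⟨l, h1, h2⟩ := this
    have hz : ∏ l ∈ univ.erase i, Matrix.diagonal d (τ l) l = 0 :=
      prod_eq_zero (mem_erase.2 ⟨h1, mem_univ l⟩) (Matrix.diagonal_apply_ne _ h2)
    simp [hz]
  · simp

/-- In a Leibniz expansion with all columns but two diagonal, only the identity and one
transposition contribute. -/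
theorem sum_perm_diagonal_erase_erase (d : κ → ℝ) {i j : κ} (hij : j ≠ i) (c c' : κ → ℝ) :
    ∑ τ : Equiv.Perm κ, ((Equiv.Perm.sign τ : ℤ) : ℝ) *
      ((∏ l ∈ (univ.erase i).erase j, Matrix.diagonal d (τ l) l) * c (τ j) * c' (τ i)) =
      (c' i * c j - c i * c' j) * ∏ l ∈ (univ.erase i).erase j, d l := by
  have hne : (1 : Equiv.Perm κ) ≠ Equiv.swap i j := by
    intro h
    have := congrArg (fun σ : Equiv.Perm κ => σ i) h
    simp at this
    exact hij this.symm
  rw [sum_eq_add 1 (Equiv.swap i j) hne]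
  · have h1 : ∏ l ∈ (univ.erase i).erase j, Matrix.diagonal d (Equiv.swap i j l) l =
        ∏ l ∈ (univ.erase i).erase j, d l := by
      refine prod_congr rfl fun l hl => ?_
      have h2 := (mem_erase.1 hl).1
      have h3 := (mem_erase.1 (mem_erase.1 hl).2).1
      rw [Equiv.swap_apply_of_ne_of_ne h3 h2, Matrix.diagonal_apply_eq]
    rw [h1, Equiv.Perm.sign_swap hij.symm]
    simp
    ring
  · intro τ _ hτ
    have : ∃ l, l ≠ i ∧ l ≠ j ∧ τ l ≠ l := by
      by_contra hc
      push Not at hc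
      rcases perm_eq_one_or_swap_of_fixes_compl hc with h | h
      · exact hτ.1 h
      · exact hτ.2 h
    obtain ⟨l, h1, h2, h3⟩ := this
    have hz : ∏ l ∈ (univ.erase i).erase j, Matrix.diagonal d (τ l) l = 0 :=
      prod_eq_zero (mem_erase.2 ⟨h2, mem_erase.2 ⟨h1, mem_univ l⟩⟩)
        (Matrix.diagonal_apply_ne _ h3)
    simp [hz]
  · simp
  · simp

/-- The first two derivatives of the determinant along a curve of matrices, at a diagonal
matrix. -/
theorem det_jet {N N1 : ℝ → Matrix κ κ ℝ} {N2 : Matrix κ κ ℝ} {d : κ → ℝ}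
    (h0 : N 0 = Matrix.diagonal d)
    (h1 : ∀ i j, ∀ᶠ t in 𝓝 (0 : ℝ), HasDerivAt (fun t => N t i j) (N1 t i j) t)
    (h2 : ∀ i j, HasDerivAt (fun t => N1 t i j) (N2 i j) 0) :
    ∃ D : ℝ → ℝ, (∀ᶠ t in 𝓝 (0 : ℝ), HasDerivAt (fun t => (N t).det) (D t) t) ∧
      D 0 = ∑ i, N1 0 i i * ∏ l ∈ univ.erase i, d l ∧
      HasDerivAt D (∑ i, N2 i i * ∏ l ∈ univ.erase i, d l +
        ∑ i, ∑ j ∈ univ.erase i, (N1 0 i i * N1 0 j j - N1 0 i j * N1 0 j i) *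
          ∏ l ∈ (univ.erase i).erase j, d l) 0 := by
  refine ⟨fun t => ∑ τ : Equiv.Perm κ, ((Equiv.Perm.sign τ : ℤ) : ℝ) *
    ∑ i, (∏ l ∈ univ.erase i, N t (τ l) l) * N1 t (τ i) i, ?_, ?_, ?_⟩
  · have h1' : ∀ᶠ t in 𝓝 (0 : ℝ), ∀ i j, HasDerivAt (fun t => N t i j) (N1 t i j) t :=
      eventually_all.2 fun i => eventually_all.2 fun j => h1 i j
    filter_upwards [h1'] with t ht
    simp only [Matrix.det_apply']
    refine HasDerivAt.fun_sum fun τ _ => HasDerivAt.const_mul _ ?_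
    simpa using HasDerivAt.fun_finsetProd (u := univ) (f := fun l t => N t (τ l) l)
      (f' := fun l => N1 t (τ l) l) fun l _ => ht (τ l) l
  · simp only [mul_sum, h0]
    rw [sum_comm]
    refine sum_congr rfl fun i _ => ?_
    rw [sum_perm_diagonal_erase d i fun a => N1 0 a i]
    ring
  · have hd : HasDerivAt (fun t => ∑ τ : Equiv.Perm κ, ((Equiv.Perm.sign τ : ℤ) : ℝ) *
        ∑ i, (∏ l ∈ univ.erase i, N t (τ l) l) * N1 t (τ i) i)
        (∑ τ : Equiv.Perm κ, ((Equiv.Perm.sign τ : ℤ) : ℝ) *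
        ∑ i, ((∑ j ∈ univ.erase i, (∏ l ∈ (univ.erase i).erase j, N 0 (τ l) l) * N1 0 (τ j) j) *
          N1 0 (τ i) i + (∏ l ∈ univ.erase i, N 0 (τ l) l) * N2 (τ i) i)) 0 := by
      refine HasDerivAt.fun_sum fun τ _ => HasDerivAt.const_mul _ (HasDerivAt.fun_sum fun i _ => ?_)
      refine HasDerivAt.fun_mul ?_ (h2 (τ i) i)
      simpa using HasDerivAt.fun_finsetProd (u := univ.erase i) (f := fun l t => N t (τ l) l)
        (f' := fun l => N1 0 (τ l) l) fun l _ => (h1 (τ l) l).self_of_nhds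
    convert hd using 1
    simp only [h0, mul_sum, sum_mul, mul_add, sum_add_distrib]
    rw [add_comm]
    congr 1
    · rw [sum_comm]
      refine sum_congr rfl fun i _ => ?_
      rw [sum_comm]
      refine sum_congr rfl fun j hj => ?_
      rw [sum_perm_diagonal_erase_erase d (mem_erase.1 hj).1 (fun a => N1 0 a j)
        fun a => N1 0 a i]
    · rw [sum_comm]
      refine sum_congr rfl fun i _ => ?_
      rw [sum_perm_diagonal_erase d i fun a => N2 a i]
      ring

theorem prod_univ_erase_coe {ι : Type*} [DecidableEq ι] {s : Finset ι} (i : s) (l : ι → ℝ) :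
    ∏ a ∈ univ.erase i, l (a : ι) = ∏ a ∈ s.erase (i : ι), l a := by
  have : s.erase (i : ι) = (univ.erase i).map (Function.Embedding.subtype _) := by
    ext a
    simp only [mem_erase, Finset.mem_map, mem_univ, and_true, Function.Embedding.coe_subtype,
      Subtype.exists, exists_and_right, exists_eq_right]
    constructor
    · rintro ⟨h1, h2⟩
      exact ⟨h2, fun h => h1 (congrArg Subtype.val h)⟩
    · rintro ⟨h2, h1⟩
      exact ⟨fun h => h1 (Subtype.ext h), h2⟩
  rw [this, prod_map]
  rfl

theorem sum_univ_erase_coe {ι : Type*} [DecidableEq ι] {s : Finset ι} (i : s) (l : ι → ℝ) :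
    ∑ a ∈ univ.erase i, l (a : ι) = ∑ a ∈ s.erase (i : ι), l a := by
  have h1 := sum_erase_eq_sub (f := fun a : s => l (a : ι)) (mem_univ i)
  have h2 := sum_erase_eq_sub (f := l) i.2
  rw [h1, h2, sum_coe_sort s l]

theorem prod_univ_erase_erase_coe {ι : Type*} [DecidableEq ι] {s : Finset ι} {i j : s}
    (l : ι → ℝ) :
    ∏ a ∈ (univ.erase i).erase j, l (a : ι) = ∏ a ∈ (s.erase (i : ι)).erase (j : ι), l a := by
  have : (s.erase (i : ι)).erase (j : ι) =
      ((univ.erase i).erase j).map (Function.Embedding.subtype _) := by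
    ext a
    simp only [mem_erase, Finset.mem_map, mem_univ, and_true, Function.Embedding.coe_subtype,
      Subtype.exists, exists_and_right, exists_eq_right]
    constructor
    · rintro ⟨h0, h1, h2⟩
      exact ⟨h2, fun h => h0 (congrArg Subtype.val h), fun h => h1 (congrArg Subtype.val h)⟩
    · rintro ⟨h2, h0, h1⟩
      exact ⟨fun h => h0 (Subtype.ext h), fun h => h1 (Subtype.ext h), h2⟩
  rw [this, prod_map]
  rfl

theorem continuous_es {ι : Type*} (j : ℕ) (s : Finset ι) :
    Continuous fun l : ι → ℝ => es l j s := by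
  unfold es
  fun_prop

variable {ι : Type*} [Fintype ι] [DecidableEq ι]

/-- The sum of the principal `k × k` minors of a matrix. -/
def minorSum (k : ℕ) (A : Matrix ι ι ℝ) : ℝ :=
  ∑ s ∈ univ.powersetCard k, (A.submatrix (Subtype.val : s → ι) (Subtype.val : s → ι)).det

theorem minorSum_diagonal (k : ℕ) (l : ι → ℝ) :
    minorSum k (Matrix.diagonal l) = es l k univ := by
  unfold minorSum es
  refine sum_congr rfl fun s _ => ?_
  rw [Matrix.submatrix_diagonal _ _ Subtype.val_injective, Matrix.det_diagonal]
  exact prod_coe_sort s l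

/-- The first two derivatives of the sum of the principal minors of size `m + 2` along a curve
of matrices, at a diagonal matrix. -/
theorem minorSum_jet (m : ℕ) {A A1 : ℝ → Matrix ι ι ℝ} {A2 : Matrix ι ι ℝ} {l : ι → ℝ}
    (h0 : A 0 = Matrix.diagonal l)
    (h1 : ∀ i j, ∀ᶠ t in 𝓝 (0 : ℝ), HasDerivAt (fun t => A t i j) (A1 t i j) t)
    (h2 : ∀ i j, HasDerivAt (fun t => A1 t i j) (A2 i j) 0) :
    ∃ D : ℝ → ℝ, (∀ᶠ t in 𝓝 (0 : ℝ), HasDerivAt (fun t => minorSum (m + 2) (A t)) (D t) t) ∧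
      D 0 = ∑ i, A1 0 i i * es l (m + 1) (univ.erase i) ∧
      HasDerivAt D (∑ i, A2 i i * es l (m + 1) (univ.erase i) +
        ∑ i, ∑ j ∈ univ.erase i, (A1 0 i i * A1 0 j j - A1 0 i j * A1 0 j i) *
          es l m ((univ.erase i).erase j)) 0 := by
  have key := fun s : Finset ι => det_jet (κ := s)
    (N := fun t => (A t).submatrix (Subtype.val : s → ι) (Subtype.val : s → ι))
    (N1 := fun t => (A1 t).submatrix (Subtype.val : s → ι) (Subtype.val : s → ι))
    (N2 := A2.submatrix (Subtype.val : s → ι) (Subtype.val : s → ι))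
    (d := fun i => l i)
    (by simp only [h0]; exact Matrix.submatrix_diagonal _ _ Subtype.val_injective)
    (fun i j => h1 i j) (fun i j => h2 i j)
  choose D hD1 hD2 hD3 using key
  have e1 : ∀ c : ι → ℝ, ∑ s ∈ (univ : Finset ι).powersetCard (m + 2), ∑ i : s, c i *
      ∏ a ∈ univ.erase i, l (a : ι) = ∑ i, c i * es l (m + 1) (univ.erase i) := by
    intro c
    have := sum_powersetCard_succ_sum (univ : Finset ι) (m + 1) fun i r => c i * ∏ a ∈ r, l a
    simp only [← mul_sum] at this
    unfold es
    rw [← this]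
    refine sum_congr rfl fun s _ => ?_
    rw [← sum_coe_sort s]
    exact sum_congr rfl fun i _ => by rw [prod_univ_erase_coe]
  have e2 : ∀ c : ι → ι → ℝ, ∑ s ∈ (univ : Finset ι).powersetCard (m + 2),
      ∑ i : s, ∑ j ∈ univ.erase i, c i j * ∏ a ∈ (univ.erase i).erase j, l (a : ι) =
        ∑ i, ∑ j ∈ univ.erase i, c i j * es l m ((univ.erase i).erase j) := by
    intro c
    have := sum_powersetCard_succ_sum (univ : Finset ι) (m + 1)
      fun i r => ∑ j ∈ r, c i j * ∏ a ∈ r.erase j, l a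
    have h3 : ∀ i, ∑ r ∈ (univ.erase i).powersetCard (m + 1), ∑ j ∈ r, c i j *
        ∏ a ∈ r.erase j, l a = ∑ j ∈ univ.erase i, c i j * es l m ((univ.erase i).erase j) := by
      intro i
      rw [sum_powersetCard_succ_sum (univ.erase i) m fun j r => c i j * ∏ a ∈ r, l a]
      simp only [← mul_sum]
      rfl
    simp only [h3] at this
    rw [← this]
    refine sum_congr rfl fun s _ => ?_
    rw [← sum_coe_sort s]
    refine sum_congr rfl fun i _ => ?_
    rw [← sum_univ_erase_coe i fun j => c i j * ∏ a ∈ (s.erase (i : ι)).erase j, l a]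
    exact sum_congr rfl fun j _ => by rw [prod_univ_erase_erase_coe]
  refine ⟨fun t => ∑ s ∈ univ.powersetCard (m + 2), D s t, ?_, ?_, ?_⟩
  · have : ∀ᶠ t in 𝓝 (0 : ℝ), ∀ s : Finset ι, HasDerivAt (fun t => ((A t).submatrix
        (Subtype.val : s → ι) (Subtype.val : s → ι)).det) (D s t) t :=
      eventually_all.2 hD1
    filter_upwards [this] with t ht
    exact HasDerivAt.fun_sum fun s _ => ht s
  · simp only [hD2]
    exact e1 fun i => A1 0 i i
  · rw [← e1 fun i => A2 i i, ← e2 fun i j => A1 0 i i * A1 0 j j - A1 0 i j * A1 0 j i,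
      ← sum_add_distrib]
    exact HasDerivAt.fun_sum fun s _ => hD3 s

/-- Concavity of `log σ_{m+2}` on the closed positive orthant, as an inequality for the second
differential. In the interior, midpoint log-concavity says that `g t * g (-t)` has a maximum at
`t = 0`, `g` being the restriction of `σ_{m+2}` to the line through `l` in direction `w`. -/
theorem es_mul_second_le_sq (m : ℕ) (hm : m + 2 ≤ Fintype.card ι) {l : ι → ℝ}
    (hl : ∀ i, 0 ≤ l i) (w : ι → ℝ) :
    es l (m + 2) univ * ∑ i, ∑ j ∈ univ.erase i, w i * w j * es l m ((univ.erase i).erase j) ≤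
      (∑ i, w i * es l (m + 1) (univ.erase i)) ^ 2 := by
  have main : ∀ l : ι → ℝ, (∀ i, 0 < l i) →
      es l (m + 2) univ * ∑ i, ∑ j ∈ univ.erase i, w i * w j * es l m ((univ.erase i).erase j) ≤
      (∑ i, w i * es l (m + 1) (univ.erase i)) ^ 2 := by
    intro l hl
    obtain ⟨D, hD1, hD2, hD3⟩ := minorSum_jet (ι := ι) m
      (A := fun t => Matrix.diagonal fun i => l i + t * w i)
      (A1 := fun _ => Matrix.diagonal w) (A2 := 0) (l := l) (by simp)
      (by
        intro i j
        refine Eventually.of_forall fun t => ?_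
        by_cases hij : i = j
        · subst hij
          simp only [Matrix.diagonal_apply_eq]
          simpa using ((hasDerivAt_id t).mul_const (w i)).const_add (l i)
        · simp only [Matrix.diagonal_apply_ne _ hij]
          exact hasDerivAt_const _ _)
      (by intro i j; exact hasDerivAt_const _ _)
    simp only [minorSum_diagonal] at hD1
    simp only [Matrix.diagonal_apply_eq] at hD2 hD3
    have hQ : ∑ i, ∑ j ∈ univ.erase i, (w i * w j - Matrix.diagonal w i j *
        Matrix.diagonal w j i) * es l m ((univ.erase i).erase j) =
        ∑ i, ∑ j ∈ univ.erase i, w i * w j * es l m ((univ.erase i).erase j) := by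
      refine sum_congr rfl fun i _ => sum_congr rfl fun j hj => ?_
      rw [Matrix.diagonal_apply_ne _ (mem_erase.1 hj).1.symm]
      simp
    rw [hQ] at hD3
    rw [← hD2]
    set Q := ∑ i, ∑ j ∈ univ.erase i, w i * w j * es l m ((univ.erase i).erase j) with hQdef
    simp only [Matrix.zero_apply, zero_mul, sum_const_zero, zero_add] at hD3
    set g : ℝ → ℝ := fun t => es (fun i => l i + t * w i) (m + 2) univ with hg
    have hneg : Tendsto (fun t : ℝ => -t) (𝓝 0) (𝓝 0) := by
      simpa using (continuous_neg.tendsto (0 : ℝ))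
    have hDneg : ∀ᶠ t in 𝓝 (0 : ℝ), HasDerivAt (fun t => g (-t)) (-D (-t)) t := by
      filter_upwards [hneg.eventually hD1] with t ht
      simpa [Function.comp_def] using HasDerivAt.comp t ht (hasDerivAt_neg t)
    have hD3neg : HasDerivAt (fun t => -D (-t)) Q 0 := by
      have h3 : HasDerivAt D Q (-0) := by simpa using hD3
      simpa [Function.comp_def] using (HasDerivAt.comp (0 : ℝ) h3 (hasDerivAt_neg 0)).fun_neg
    have hpos : ∀ᶠ t in 𝓝 (0 : ℝ), ∀ i, 0 < l i + t * w i := by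
      refine eventually_all.2 fun i => ?_
      have : ContinuousAt (fun t : ℝ => l i + t * w i) 0 := by fun_prop
      exact this.eventually_const_lt (by simpa using hl i)
    have hmax : IsLocalMax (fun t => g t * g (-t)) 0 := by
      filter_upwards [hpos, hneg.eventually hpos] with t h1 h2
      have := es_mul_es_le h1 h2 univ (m + 2) (by simpa using hm)
      have e : (fun i => 2⁻¹ * ((fun i => l i + t * w i) + fun i => l i + -t * w i) i) = l := by
        ext i
        simp only [Pi.add_apply]
        ring
      rw [e] at this
      simpa [hg, sq] using this
    have := (deriv_zero_and_second_nonpos_of_isLocalMax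
      (g' := fun t => D t * g (-t) + g t * -D (-t))
      (c := Q * g (-0) + D 0 * -D (-0) + (D 0 * -D (-0) + g 0 * Q)) ?_ ?_ hmax).2
    · have e : g 0 = es l (m + 2) univ := by simp [hg]
      rw [neg_zero, e] at this
      nlinarith
    · filter_upwards [hD1, hDneg] with t h1 h2
      exact h1.mul h2
    · exact (hD3.mul hDneg.self_of_nhds).add (hD1.self_of_nhds.mul hD3neg)
  -- the boundary of the orthant is reached by continuity
  have hlim : Tendsto (fun ε : ℝ => fun i => l i + ε) (𝓝[>] 0) (𝓝 l) := by
    refine tendsto_nhdsWithin_of_tendsto_nhds ?_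
    have : Continuous fun ε : ℝ => fun i => l i + ε := by fun_prop
    simpa using this.tendsto 0
  have c1 : Continuous fun l : ι → ℝ => es l (m + 2) univ *
      ∑ i, ∑ j ∈ univ.erase i, w i * w j * es l m ((univ.erase i).erase j) :=
    (continuous_es _ _).mul (continuous_finsetSum _ fun i _ => continuous_finsetSum _
      fun j _ => continuous_const.mul (continuous_es _ _))
  have c2 : Continuous fun l : ι → ℝ => (∑ i, w i * es l (m + 1) (univ.erase i)) ^ 2 :=
    (continuous_finsetSum _ fun i _ => continuous_const.mul (continuous_es _ _)).pow 2
  refine le_of_tendsto_of_tendsto ((c1.tendsto l).comp hlim) ((c2.tendsto l).comp hlim) ?_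
  filter_upwards [self_mem_nhdsWithin] with ε hε
  exact main _ fun i => add_pos_of_nonneg_of_pos (hl i) hε

end Minors

section EigenvalueInequality

/-! ### Third order terms at the largest eigenvalue -/

theorem mul_mul_le_of_sq_le {c X Y : ℝ} (hX : 0 ≤ X) (hY : 0 ≤ Y) (h : c ^ 2 ≤ 4 * X * Y)
    (x y : ℝ) : c * x * y ≤ X * x ^ 2 + Y * y ^ 2 := by
  rcases hX.eq_or_lt with rfl | hX
  · have : c = 0 := by
      have : c ^ 2 ≤ 0 := by simpa using h
      exact pow_eq_zero_iff (two_ne_zero) |>.1 (le_antisymm this (sq_nonneg c))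
    subst this
    have := mul_nonneg hY (sq_nonneg y)
    linarith
  · have h1 : 0 ≤ (2 * X * x - c * y) ^ 2 + (4 * X * Y - c ^ 2) * y ^ 2 :=
      add_nonneg (sq_nonneg _) (mul_nonneg (sub_nonneg.2 h) (sq_nonneg y))
    have h2 : (2 * X * x - c * y) ^ 2 + (4 * X * Y - c ^ 2) * y ^ 2 =
        4 * X * (X * x ^ 2 + Y * y ^ 2 - c * x * y) := by ring
    rw [h2] at h1
    have := nonneg_of_mul_nonneg_right h1 (by positivity)
    linarith

theorem es_congr {ι : Type*} {l l' : ι → ℝ} {s : Finset ι} (h : ∀ i ∈ s, l i = l' i) (j : ℕ) :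
    es l j s = es l' j s :=
  sum_congr rfl fun _ ht => prod_congr rfl fun i hi => h i ((mem_powersetCard.1 ht).1 hi)

variable {ι : Type*} [Fintype ι] [DecidableEq ι]

/-- A symmetric off-diagonal double sum, with the row and the column of index `a` split off. -/
theorem sum_sum_erase_split {f : ι → ι → ℝ} (hf : ∀ i j, f i j = f j i) (a : ι) :
    ∑ i, ∑ j ∈ univ.erase i, f i j = 2 * ∑ j ∈ univ.erase a, f a j +
      ∑ i ∈ univ.erase a, ∑ j ∈ (univ.erase i).erase a, f i j := by
  rw [← add_sum_erase univ _ (mem_univ a)]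
  have : ∑ i ∈ univ.erase a, ∑ j ∈ univ.erase i, f i j =
      ∑ i ∈ univ.erase a, (f a i + ∑ j ∈ (univ.erase i).erase a, f i j) := by
    refine sum_congr rfl fun i hi => ?_
    rw [← add_sum_erase (univ.erase i) _ (mem_erase.2 ⟨(mem_erase.1 hi).1.symm, mem_univ a⟩),
      hf i a]
  rw [this, sum_add_distrib]
  ring

/-- A weak form of Newton's inequality, for the numbers `l` with those of index `i`, `j` left
out. It follows from concavity at the point where these two are replaced by `0`. -/
theorem es_newton_erase_erase (m : ℕ) (hm : m + 2 ≤ Fintype.card ι) {l : ι → ℝ}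
    (hl : ∀ i, 0 ≤ l i) {i j : ι} (hij : j ≠ i) :
    es l (m + 2) ((univ.erase i).erase j) * es l m ((univ.erase i).erase j) ≤
      4 * es l (m + 1) ((univ.erase i).erase j) ^ 2 := by
  set s := (univ.erase i).erase j with hs
  set l' : ι → ℝ := fun a => if a = i ∨ a = j then 0 else l a with hl'
  set w : ι → ℝ := fun a => if a = i ∨ a = j then 1 else 0 with hw
  have hl0 : ∀ a, 0 ≤ l' a := fun a => by
    simp only [hl']
    split_ifs
    exacts [le_rfl, hl a]
  have hw0 : ∀ a, 0 ≤ w a := fun a => by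
    simp only [hw]
    split_ifs <;> norm_num
  have hi : l' i = 0 := by simp [hl']
  have hj : l' j = 0 := by simp [hl']
  have hc : ∀ k, es l' k s = es l k s := fun k => es_congr (fun a ha => by
    have h1 := (mem_erase.1 ha).1
    have h2 := (mem_erase.1 (mem_erase.1 ha).2).1
    simp [hl', h1, h2]) k
  have e1 : es l' (m + 1) (univ.erase i) = es l (m + 1) s := by
    rw [es_erase l' m (mem_erase.2 ⟨hij, mem_univ j⟩), hj, ← hs, zero_mul, zero_add, hc]
  have e2 : es l' (m + 1) (univ.erase j) = es l (m + 1) s := by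
    rw [es_erase l' m (mem_erase.2 ⟨hij.symm, mem_univ i⟩), hi, erase_right_comm, ← hs, zero_mul,
      zero_add, hc]
  have e3 : es l' (m + 2) univ = es l (m + 2) s := by
    rw [es_erase l' _ (mem_univ i), hi, zero_mul, zero_add,
      es_erase l' _ (mem_erase.2 ⟨hij, mem_univ j⟩), hj, ← hs, zero_mul, zero_add, hc]
  have key := es_mul_second_le_sq m hm hl0 w
  have hsum : ∑ a, w a * es l' (m + 1) (univ.erase a) = 2 * es l (m + 1) s := by
    rw [sum_eq_add i j hij.symm]
    · simp [hw, e1, e2]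
      ring
    · intro c _ hc
      simp [hw, hc.1, hc.2]
    · simp
    · simp
  rw [hsum, e3] at key
  have hQ : es l m s ≤ ∑ a, ∑ b ∈ univ.erase a, w a * w b * es l' m ((univ.erase a).erase b) := by
    have n1 : ∀ a b, 0 ≤ w a * w b * es l' m ((univ.erase a).erase b) := fun a b =>
      mul_nonneg (mul_nonneg (hw0 a) (hw0 b)) (es_nonneg hl0 _ _)
    calc es l m s = w i * w j * es l' m ((univ.erase i).erase j) := by
          rw [← hs, hc]; simp [hw]
      _ ≤ ∑ b ∈ univ.erase i, w i * w b * es l' m ((univ.erase i).erase b) :=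
        single_le_sum (f := fun b => w i * w b * es l' m ((univ.erase i).erase b))
          (fun b _ => n1 i b) (mem_erase.2 ⟨hij, mem_univ j⟩)
      _ ≤ _ := single_le_sum (f := fun a => ∑ b ∈ univ.erase a,
          w a * w b * es l' m ((univ.erase a).erase b))
          (fun a _ => sum_nonneg fun b _ => n1 a b) (mem_univ i)
  nlinarith [mul_le_mul_of_nonneg_left hQ (es_nonneg hl (m + 2) s)]

/-- The two-variable expansion of `∂ᵢσ ∂ⱼσ - σ ∂ᵢ∂ⱼσ`. -/
theorem es_first_mul_first_sub (m : ℕ) (l : ι → ℝ) {i j : ι} (hij : j ≠ i) :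
    es l (m + 1) (univ.erase i) * es l (m + 1) (univ.erase j) -
      es l (m + 2) univ * es l m ((univ.erase i).erase j) =
    es l (m + 1) ((univ.erase i).erase j) ^ 2 -
      es l (m + 2) ((univ.erase i).erase j) * es l m ((univ.erase i).erase j) := by
  rw [es_erase l _ (mem_univ i), es_erase l _ (mem_erase.2 ⟨hij, mem_univ j⟩),
    es_erase l (m + 1) (mem_erase.2 ⟨hij, mem_univ j⟩),
    es_erase l m (mem_erase.2 ⟨hij.symm, mem_univ i⟩), erase_right_comm (a := j) (b := i)]
  ring

/-- The defect of `l a ∂ₐσ` from `σ` is small when `l a` is large. -/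
theorem es_erase_le (k : ℕ) {l : ι → ℝ} (hl : ∀ i, 0 ≤ l i) (a : ι) {R : ℝ} (hR : 1 ≤ R)
    (hσR : es l (k + 1) univ ≤ R) :
    l a * es l (k + 1) (univ.erase a) ≤ 2 ^ Fintype.card ι * R * es l (k + 1) univ := by
  have h1 : es l (k + 1) (univ.erase a) ≤ R := (es_mono_set hl _ (erase_subset _ _)).trans hσR
  have h2 := es_succ_le hl k (univ.erase a) hR h1
  have h3 : (2 : ℝ) ^ #(univ.erase a) ≤ 2 ^ Fintype.card ι :=
    pow_le_pow_right₀ (by norm_num) (card_le_univ _)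
  have h4 : l a * es l k (univ.erase a) ≤ es l (k + 1) univ := by
    rw [es_erase l k (mem_univ a)]
    linarith [es_nonneg hl (k + 1) (univ.erase a)]
  have h5 := es_nonneg hl k (univ.erase a)
  have hK : 0 ≤ (2 : ℝ) ^ Fintype.card ι * R := by positivity
  calc l a * es l (k + 1) (univ.erase a)
      ≤ l a * (2 ^ Fintype.card ι * R * es l k (univ.erase a)) := by
        refine mul_le_mul_of_nonneg_left (h2.trans ?_) (hl a)
        gcongr
    _ = 2 ^ Fintype.card ι * R * (l a * es l k (univ.erase a)) := by ring
    _ ≤ _ := mul_le_mul_of_nonneg_left h4 hK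

/-- The estimate of the third order terms in the direction of the largest eigenvalue. Write
`w = w_a e_a + w'`: on `w'` the inequality is the concavity of `log σ`, the square of `w_a` is
governed by `σ - l_a ∂ₐσ`, and the coefficients of the mixed terms are
`∂ₐσ ∂_qσ - σ ∂ₐ∂_qσ`, all small when `l a` is large. -/
theorem third_order_estimate (m : ℕ) (hm : m + 2 ≤ Fintype.card ι) {l : ι → ℝ}
    (hl : ∀ i, 0 ≤ l i) (a : ι) {R η : ℝ} (hR : 1 ≤ R) (hσ : 0 < es l (m + 2) univ)
    (hσR : es l (m + 2) univ ≤ R) (hη : 0 < η) (hla : 1 ≤ l a)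
    (hbig : 18 * Fintype.card ι * (2 ^ Fintype.card ι * R) ≤ η * l a) (w : ι → ℝ) :
    l a * ∑ i, ∑ j ∈ univ.erase i, w i * w j * es l m ((univ.erase i).erase j) +
        es l (m + 1) (univ.erase a) * w a ^ 2 ≤
      l a * ((∑ i, w i * es l (m + 1) (univ.erase i)) ^ 2 / es l (m + 2) univ) +
        ∑ j ∈ univ.erase a, es l (m + 1) (univ.erase j) * w j ^ 2 +
        η * (es l (m + 1) (univ.erase a) * w a ^ 2) := by
  set σ := es l (m + 2) univ with hσdef
  set K : ℝ := 2 ^ Fintype.card ι * R with hK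
  set c : ℝ := (Fintype.card ι : ℝ) with hcdef
  have hc1 : (2 : ℝ) ≤ c := by rw [hcdef]; exact_mod_cast (by omega : 2 ≤ Fintype.card ι)
  have hK1 : 0 < K := by positivity
  have hl1 : 0 < l a := by linarith
  set F : ι → ℝ := fun i => es l (m + 1) (univ.erase i) with hF
  set F2 : ι → ι → ℝ := fun i j => es l m ((univ.erase i).erase j) with hF2
  have hF0 : ∀ i, 0 ≤ F i := fun i => es_nonneg hl _ _
  have hF2s : ∀ i j, F2 i j = F2 j i := fun i j => by simp only [hF2]; rw [erase_right_comm]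
  have hFa : l a * F a ≤ σ := by
    rw [hσdef, es_erase l (m + 1) (mem_univ a)]
    linarith [es_nonneg hl (m + 2) (univ.erase a)]
  -- the square of `w a`
  have hdiag : σ - l a * F a ≤ η / 2 * σ := by
    have h1 := es_erase_le (m + 1) hl a hR hσR
    have h2 : σ - l a * F a = es l (m + 2) (univ.erase a) := by
      rw [hσdef, es_erase l (m + 1) (mem_univ a)]; ring
    rw [h2]
    have h3 : 2 * K ≤ η * l a := by nlinarith
    have h4 : l a * es l (m + 2) (univ.erase a) ≤ l a * (η / 2 * σ) := by nlinarith
    exact le_of_mul_le_mul_left h4 hl1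
  -- the mixed terms
  have hcross : ∀ q ∈ univ.erase a, 2 * l a * (σ * F2 a q - F a * F q) * w a * w q ≤
      η / (2 * c) * (σ * F a) * w a ^ 2 + σ * F q * w q ^ 2 := by
    intro q hq
    have hqa : q ≠ a := (mem_erase.1 hq).1
    set s1 := es l (m + 1) ((univ.erase a).erase q) with hs1
    set s2 := es l m ((univ.erase a).erase q) with hs2
    have p1 : 0 ≤ s1 := es_nonneg hl _ _
    have p2 : 0 ≤ s2 := es_nonneg hl _ _
    have d1 := es_first_mul_first_sub m l hqa
    have d2 := es_newton_erase_erase m hm hl hqa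
    have d3 : 0 ≤ es l (m + 2) ((univ.erase a).erase q) * s2 := mul_nonneg (es_nonneg hl _ _) p2
    -- the coefficient is at most `3 s₁²`, and `s₁` is small compared with `F a`, `σ` and `F q`
    have habs : (σ * F2 a q - F a * F q) ^ 2 ≤ 9 * s1 ^ 4 := by
      have e1 : σ * F2 a q - F a * F q ≤ 3 * s1 ^ 2 := by
        simp only [hF, hF2, ← hs2, ← hs1, ← hσdef] at d1 d2 ⊢
        linarith
      have e2 : -(3 * s1 ^ 2) ≤ σ * F2 a q - F a * F q := by
        simp only [hF, hF2, ← hs2, ← hs1, ← hσdef] at d1 d2 ⊢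
        linarith [sq_nonneg s1]
      calc _ ≤ (3 * s1 ^ 2) ^ 2 := sq_le_sq' e2 e1
        _ = _ := by ring
    have b1 : s1 ≤ F a := es_mono_set hl _ (erase_subset _ _)
    have b2 : l a * s2 ≤ F q := by
      simp only [hF]
      rw [es_erase l m (mem_erase.2 ⟨hqa.symm, mem_univ a⟩), erase_right_comm, ← hs2]
      linarith [es_nonneg hl (m + 1) ((univ.erase a).erase q)]
    have b3 : l a * s1 ≤ σ := (mul_le_mul_of_nonneg_left b1 hl1.le).trans hFa
    have b4 : s1 ≤ K * s2 := by
      have : s1 ≤ R := by nlinarith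
      have h2 := es_succ_le hl m ((univ.erase a).erase q) hR this
      have h3 : (2 : ℝ) ^ #((univ.erase a).erase q) ≤ 2 ^ Fintype.card ι :=
        pow_le_pow_right₀ (by norm_num) (card_le_univ _)
      exact h2.trans (mul_le_mul_of_nonneg_right
        (by rw [hK]; exact mul_le_mul_of_nonneg_right h3 (by linarith)) p2)
    have low : l a ^ 3 * s1 ^ 3 * s2 ≤ σ ^ 2 * F a * F q := by
      calc l a ^ 3 * s1 ^ 3 * s2 = (l a * s1) ^ 2 * s1 * (l a * s2) := by ring
        _ ≤ σ ^ 2 * F a * F q := by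
          have : (l a * s1) ^ 2 ≤ σ ^ 2 := pow_le_pow_left₀ (by positivity) b3 2
          have := mul_le_mul this b1 p1 (by positivity)
          exact mul_le_mul this b2 (by positivity) (by have := hF0 a; positivity)
    refine mul_mul_le_of_sq_le (by have := hF0 a; positivity) (by have := hF0 q; positivity) ?_ _ _
    calc (2 * l a * (σ * F2 a q - F a * F q)) ^ 2
        = 4 * l a ^ 2 * (σ * F2 a q - F a * F q) ^ 2 := by ring
      _ ≤ 4 * l a ^ 2 * (9 * s1 ^ 4) := by gcongr
      _ = 36 * l a ^ 2 * s1 ^ 3 * s1 := by ring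
      _ ≤ 36 * l a ^ 2 * s1 ^ 3 * (K * s2) := by gcongr
      _ = 2 / c * (18 * c * K) * (l a ^ 2 * s1 ^ 3 * s2) := by field_simp; ring
      _ ≤ 2 / c * (η * l a) * (l a ^ 2 * s1 ^ 3 * s2) := by gcongr
      _ = 2 * η / c * (l a ^ 3 * s1 ^ 3 * s2) := by ring
      _ ≤ 2 * η / c * (σ ^ 2 * F a * F q) := by gcongr
      _ = 4 * (η / (2 * c) * (σ * F a)) * (σ * F q) := by field_simp; ring
  have hcross' : 2 * l a * w a * ∑ q ∈ univ.erase a, (σ * F2 a q - F a * F q) * w q ≤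
      η / 2 * (σ * F a) * w a ^ 2 + σ * ∑ q ∈ univ.erase a, F q * w q ^ 2 := by
    calc 2 * l a * w a * ∑ q ∈ univ.erase a, (σ * F2 a q - F a * F q) * w q
        = ∑ q ∈ univ.erase a, 2 * l a * (σ * F2 a q - F a * F q) * w a * w q := by
          rw [mul_sum]; exact sum_congr rfl fun q _ => by ring
      _ ≤ ∑ q ∈ univ.erase a,
          (η / (2 * c) * (σ * F a) * w a ^ 2 + σ * F q * w q ^ 2) := sum_le_sum hcross
      _ = #(univ.erase a) * (η / (2 * c) * (σ * F a) * w a ^ 2) +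
          σ * ∑ q ∈ univ.erase a, F q * w q ^ 2 := by
        rw [sum_add_distrib, sum_const, nsmul_eq_mul, mul_sum]
        congr 1
        exact sum_congr rfl fun q _ => by ring
      _ ≤ c * (η / (2 * c) * (σ * F a) * w a ^ 2) +
          σ * ∑ q ∈ univ.erase a, F q * w q ^ 2 := by
        have : (#(univ.erase a) : ℝ) ≤ c := by rw [hcdef]; exact_mod_cast card_le_univ _
        have := hF0 a
        gcongr
      _ = _ := by field_simp
  -- concavity on the remaining components
  set w' : ι → ℝ := fun i => if i = a then 0 else w i with hw'
  have hconc := es_mul_second_le_sq m hm hl w'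
  have hsplit := fun v : ι → ℝ => sum_sum_erase_split (f := fun i j => v i * v j * F2 i j)
    (fun i j => by rw [hF2s i j]; ring) a
  have hrest : ∑ i ∈ univ.erase a, ∑ j ∈ (univ.erase i).erase a, w' i * w' j * F2 i j =
      ∑ i ∈ univ.erase a, ∑ j ∈ (univ.erase i).erase a, w i * w j * F2 i j := by
    refine sum_congr rfl fun i hi => sum_congr rfl fun j hj => ?_
    simp [hw', (mem_erase.1 hi).1, (mem_erase.1 hj).1]
  have hs' : ∑ i, w' i * F i = ∑ i ∈ univ.erase a, w i * F i := by
    rw [← add_sum_erase univ _ (mem_univ a)]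
    have : w' a = 0 := by simp [hw']
    rw [this, zero_mul, zero_add]
    exact sum_congr rfl fun i hi => by simp [hw', (mem_erase.1 hi).1]
  have hq' := hsplit w'
  have hwa : w' a = 0 := by simp [hw']
  simp only [hwa, zero_mul, sum_const_zero, mul_zero, zero_add, hrest] at hq'
  change σ * ∑ i, ∑ j ∈ univ.erase i, w' i * w' j * F2 i j ≤ (∑ i, w' i * F i) ^ 2 at hconc
  rw [hq', hs'] at hconc
  change l a * ∑ i, ∑ j ∈ univ.erase i, w i * w j * F2 i j + F a * w a ^ 2 ≤
    l a * ((∑ i, w i * F i) ^ 2 / σ) + ∑ j ∈ univ.erase a, F j * w j ^ 2 + η * (F a * w a ^ 2)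
  rw [hsplit w, ← add_sum_erase univ (fun i => w i * F i) (mem_univ a)]
  have hcs : ∑ q ∈ univ.erase a, (σ * F2 a q - F a * F q) * w q =
      σ * ∑ q ∈ univ.erase a, F2 a q * w q - F a * ∑ q ∈ univ.erase a, w q * F q := by
    rw [mul_sum, mul_sum, ← sum_sub_distrib]
    exact sum_congr rfl fun q _ => by ring
  rw [hcs] at hcross'
  have hcs2 : ∑ j ∈ univ.erase a, w a * w j * F2 a j = w a * ∑ q ∈ univ.erase a, F2 a q * w q := by
    rw [mul_sum]
    exact sum_congr rfl fun q _ => by ring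
  rw [hcs2]
  set Q' := ∑ i ∈ univ.erase a, ∑ j ∈ (univ.erase i).erase a, w i * w j * F2 i j
  set S := ∑ q ∈ univ.erase a, w q * F q
  set r := ∑ q ∈ univ.erase a, F2 a q * w q
  set G := ∑ j ∈ univ.erase a, F j * w j ^ 2
  have hd2 : F a * w a ^ 2 * (σ - l a * F a) ≤ F a * w a ^ 2 * (η / 2 * σ) :=
    mul_le_mul_of_nonneg_left hdiag (mul_nonneg (hF0 a) (sq_nonneg _))
  have hc2 : l a * (σ * Q') ≤ l a * S ^ 2 := mul_le_mul_of_nonneg_left hconc hl1.le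
  have hfin : σ * (l a * (2 * (w a * r) + Q') + F a * w a ^ 2) ≤
      σ * (l a * ((w a * F a + S) ^ 2 / σ) + G + η * (F a * w a ^ 2)) := by
    have e : σ * (l a * ((w a * F a + S) ^ 2 / σ) + G + η * (F a * w a ^ 2)) =
        l a * (w a * F a + S) ^ 2 + σ * G + σ * (η * (F a * w a ^ 2)) := by
      field_simp
    rw [e]
    linarith
  exact le_of_mul_le_mul_left hfin hσ

end EigenvalueInequality

section EigenvalueBound

variable {ι : Type*} [Fintype ι] [DecidableEq ι]

/-! ### The algebra of the maximum principle -/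

/-- The third order terms of the linearised equation at the maximum point, bounded below. The
terms `T a j` with `j ≠ a` have a nonnegative coefficient, and those in `T j j` are estimated by
`third_order_estimate`. -/
theorem third_order_terms_ge (m : ℕ) (hm : m + 2 ≤ Fintype.card ι) {l : ι → ℝ}
    (hl : ∀ i, 0 ≤ l i) (a : ι) {R η : ℝ} (hR : 1 ≤ R) (hσ : 0 < es l (m + 2) univ)
    (hσR : es l (m + 2) univ ≤ R) (hη : 0 < η) (hla : 1 ≤ l a)
    (hbig : 18 * Fintype.card ι * (2 ^ Fintype.card ι * R) ≤ η * l a)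
    (T : ι → ι → ℝ) (hT : ∀ i j, T i j = T j i) :
    -(l a * ((∑ i, T i i * es l (m + 1) (univ.erase i)) ^ 2 / es l (m + 2) univ)) -
        η * (es l (m + 1) (univ.erase a) * T a a ^ 2) ≤
      -(l a * ∑ i, ∑ j ∈ univ.erase i, (T i i * T j j - T i j * T j i) *
          es l m ((univ.erase i).erase j)) +
        ∑ j, es l (m + 1) (univ.erase j) * (∑ p, T p j ^ 2 - 2 * T a j ^ 2) := by
  have key := third_order_estimate m hm hl a hR hσ hσR hη hla hbig fun i => T i i
  set F : ι → ℝ := fun i => es l (m + 1) (univ.erase i) with hF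
  set F2 : ι → ι → ℝ := fun i j => es l m ((univ.erase i).erase j) with hF2
  have hF0 : ∀ i, 0 ≤ F i := fun i => es_nonneg hl _ _
  have hF20 : ∀ i j, 0 ≤ F2 i j := fun i j => es_nonneg hl _ _
  have hF2s : ∀ i j, F2 i j = F2 j i := fun i j => by simp only [hF2]; rw [erase_right_comm]
  change l a * ∑ i, ∑ j ∈ univ.erase i, T i i * T j j * F2 i j + F a * T a a ^ 2 ≤
    l a * ((∑ i, T i i * F i) ^ 2 / es l (m + 2) univ) + ∑ j ∈ univ.erase a, F j * T j j ^ 2 +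
      η * (F a * T a a ^ 2) at key
  change -(l a * ((∑ i, T i i * F i) ^ 2 / es l (m + 2) univ)) - η * (F a * T a a ^ 2) ≤
    -(l a * ∑ i, ∑ j ∈ univ.erase i, (T i i * T j j - T i j * T j i) * F2 i j) +
      ∑ j, F j * (∑ p, T p j ^ 2 - 2 * T a j ^ 2)
  have e1 : ∑ i, ∑ j ∈ univ.erase i, (T i i * T j j - T i j * T j i) * F2 i j =
      ∑ i, ∑ j ∈ univ.erase i, T i i * T j j * F2 i j -
        ∑ i, ∑ j ∈ univ.erase i, T i j ^ 2 * F2 i j := by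
    rw [← sum_sub_distrib]
    refine sum_congr rfl fun i _ => ?_
    rw [← sum_sub_distrib]
    exact sum_congr rfl fun j _ => by rw [hT j i]; ring
  have e2 : 2 * ∑ j ∈ univ.erase a, T a j ^ 2 * F2 a j ≤
      ∑ i, ∑ j ∈ univ.erase i, T i j ^ 2 * F2 i j := by
    rw [sum_sum_erase_split (f := fun i j => T i j ^ 2 * F2 i j)
      (fun i j => by rw [hF2s i j, hT i j]) a]
    have : 0 ≤ ∑ i ∈ univ.erase a, ∑ j ∈ (univ.erase i).erase a, T i j ^ 2 * F2 i j :=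
      sum_nonneg fun i _ => sum_nonneg fun j _ => mul_nonneg (sq_nonneg _) (hF20 i j)
    linarith
  have e3 : F a * (∑ j ∈ univ.erase a, T a j ^ 2) - F a * T a a ^ 2 +
      ∑ j ∈ univ.erase a, F j * (T j j ^ 2 - T a j ^ 2) ≤
      ∑ j, F j * (∑ p, T p j ^ 2 - 2 * T a j ^ 2) := by
    rw [← add_sum_erase univ (fun j => F j * (∑ p, T p j ^ 2 - 2 * T a j ^ 2)) (mem_univ a)]
    refine add_le_add (le_of_eq ?_) (sum_le_sum fun j hj => ?_)
    · have : ∑ p ∈ univ.erase a, T p a ^ 2 = ∑ p ∈ univ.erase a, T a p ^ 2 :=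
        sum_congr rfl fun p _ => by rw [hT p a]
      rw [← add_sum_erase univ (fun p => T p a ^ 2) (mem_univ a), this]
      ring
    · have hja : j ≠ a := (mem_erase.1 hj).1
      refine mul_le_mul_of_nonneg_left ?_ (hF0 j)
      have : T a j ^ 2 + T j j ^ 2 ≤ ∑ p, T p j ^ 2 := by
        rw [← sum_pair (f := fun p => T p j ^ 2) hja.symm]
        exact sum_le_sum_of_subset_of_nonneg (subset_univ _) fun _ _ _ => sq_nonneg _
      linarith
  have e4 : 0 ≤ ∑ j ∈ univ.erase a, (2 * l a * F2 a j + F a - F j) * T a j ^ 2 := by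
    refine sum_nonneg fun j hj => mul_nonneg ?_ (sq_nonneg _)
    have hja : j ≠ a := (mem_erase.1 hj).1
    have f1 : F a = l j * F2 a j + es l (m + 1) ((univ.erase a).erase j) :=
      es_erase l m (mem_erase.2 ⟨hja, mem_univ j⟩)
    have f2 : F j = l a * F2 a j + es l (m + 1) ((univ.erase a).erase j) := by
      rw [hF2s a j, erase_right_comm]
      exact es_erase l m (mem_erase.2 ⟨hja.symm, mem_univ a⟩)
    have := mul_nonneg (hl j) (hF20 a j)
    have := mul_nonneg (hl a) (hF20 a j)
    linarith
  have e5 : ∑ j ∈ univ.erase a, (2 * l a * F2 a j + F a - F j) * T a j ^ 2 =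
      l a * (2 * ∑ j ∈ univ.erase a, T a j ^ 2 * F2 a j) + F a * (∑ j ∈ univ.erase a, T a j ^ 2) -
        ∑ j ∈ univ.erase a, F j * T a j ^ 2 := by
    rw [mul_sum, mul_sum, mul_sum, ← sum_add_distrib, ← sum_sub_distrib]
    exact sum_congr rfl fun j _ => by ring
  have e6 : ∑ j ∈ univ.erase a, F j * (T j j ^ 2 - T a j ^ 2) =
      ∑ j ∈ univ.erase a, F j * T j j ^ 2 - ∑ j ∈ univ.erase a, F j * T a j ^ 2 := by
    rw [← sum_sub_distrib]
    exact sum_congr rfl fun j _ => by ring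
  have e7 := mul_le_mul_of_nonneg_left e2 (hl a)
  rw [e1]
  linarith

/-- The weights of the radial terms: a vector `y` in the kernel of the diagonal matrix only sees
the coefficient `σ_{m+1}`, and `∑ ∂ⱼσ_{m+2}` is at least twice as large. -/
theorem sum_es_mul_one_sub_nonneg (m : ℕ) (hm : m + 3 ≤ Fintype.card ι) {l y : ι → ℝ}
    (hl : ∀ i, 0 ≤ l i) (hly : ∀ j, l j * y j = 0) (hy : ∑ j, y j ^ 2 = 1) :
    0 ≤ ∑ j, es l (m + 1) (univ.erase j) * (1 - 2 * y j ^ 2) := by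
  have h1 : ∀ j, es l (m + 1) (univ.erase j) * y j ^ 2 = es l (m + 1) univ * y j ^ 2 := by
    intro j
    rw [es_erase l m (mem_univ j)]
    linear_combination (-(es l m (univ.erase j) * y j)) * hly j
  have h2 : ∑ j, es l (m + 1) (univ.erase j) * (1 - 2 * y j ^ 2) =
      ∑ j, es l (m + 1) (univ.erase j) - 2 * (es l (m + 1) univ * ∑ j, y j ^ 2) := by
    rw [mul_sum, mul_sum, ← sum_sub_distrib]
    refine sum_congr rfl fun j _ => ?_
    rw [← h1]
    ring
  rw [h2, hy, sum_es_erase, card_univ]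
  have h3 := es_nonneg hl (m + 1) univ
  have h4 : (m + 3 : ℝ) ≤ Fintype.card ι := by exact_mod_cast hm
  push_cast
  nlinarith

/-- The conclusion of the maximum principle, as a statement about the numbers involved. At the
maximum point `l` are the eigenvalues of the Hessian of the homogeneous extension `u` of `h` in
an eigenbasis, `l a` the largest one, `T` and `V` are third derivatives of `u` in one
direction `a` and fourth derivatives of `u` in two directions `a`, `y` and `v` are the
coordinates of the point and of the gradient of `u`, `W` are contracted third derivatives of `u`,
and `γ` is the gradient part of the differential of the right-hand side. Hypotheses `h1` and `h2`
are the first and second order conditions at the maximum, `h3` and `h4` come from the equation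
differentiated in the direction `a`, and `h5` from the equation differentiated along the gradient
of `u`. -/
theorem eigenvalue_le_of_max (m : ℕ) (hm : m + 3 ≤ Fintype.card ι) {l y v V W γ : ι → ℝ}
    {T : ι → ι → ℝ} (hl : ∀ i, 0 ≤ l i) (a : ι) {R μ N A C₁ C₂ C₃ C₄ : ℝ} (hR : 1 ≤ R)
    (hμ : 0 < μ) (hσμ : μ ≤ es l (m + 2) univ) (hσR : es l (m + 2) univ ≤ R)
    (hN : 1 ≤ N) (hC₃ : 0 ≤ C₃) (hla : 1 ≤ l a)
    (hbig : 18 * Fintype.card ι * (2 ^ Fintype.card ι * R) ≤ (N ^ 2)⁻¹ * l a)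
    (hNbig : C₁ + C₃ + C₄ ^ 2 / μ + A ^ 2 * R + 1 ≤ N * μ / 4)
    (hT : ∀ i j, T i j = T j i)
    (hly : ∀ j, l j * y j = 0) (hy : ∑ j, y j ^ 2 = 1) (hv : |v a| ≤ A)
    (h1 : ∀ j, T a j / l a + y j + N * (v j * l j) = 0)
    (h2 : ∀ j, V j / l a + (∑ p, T p j ^ 2 - 2 * T a j ^ 2) / l a ^ 2 + (1 - 2 * y j ^ 2) +
      N * (l j ^ 2 + W j) ≤ 0)
    (h3 : |∑ i, T i i * es l (m + 1) (univ.erase i)| ≤ C₄ * l a)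
    (h4 : -(C₁ * l a ^ 2) + ∑ j, γ j * T a j ≤ ∑ j, V j * es l (m + 1) (univ.erase j) +
      ∑ i, ∑ j ∈ univ.erase i, (T i i * T j j - T i j * T j i) * es l m ((univ.erase i).erase j))
    (h5 : -C₂ + ∑ j, γ j * (l j * v j) ≤ ∑ j, W j * es l (m + 1) (univ.erase j))
    (h6 : |∑ j, γ j * y j| ≤ C₃) :
    l a ≤ N * C₂ := by
  set L := l a with hL
  have hL0 : 0 < L := by linarith
  have hN0 : 0 < N := by linarith
  set σ := es l (m + 2) univ with hσ
  have hσ0 : 0 < σ := by linarith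
  have hη : 0 < (N ^ 2)⁻¹ := by positivity
  have hthird := third_order_terms_ge m (by omega) hl a hR hσ0 hσR hη hla hbig T hT
  set F : ι → ℝ := fun i => es l (m + 1) (univ.erase i) with hF
  have hF0 : ∀ i, 0 ≤ F i := fun i => es_nonneg hl _ _
  have hrad := sum_es_mul_one_sub_nonneg m hm hl hly hy
  have hFL : L * F a ≤ σ := by
    rw [hσ, es_erase l (m + 1) (mem_univ a)]
    linarith [es_nonneg hl (m + 2) (univ.erase a)]
  -- the coefficient of the direction `a` has size `σ / l a`
  have hFL2 : σ / 2 ≤ L * F a := by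
    have q1 := es_erase_le (m + 1) hl a hR hσR
    have q2 : σ - L * F a = es l (m + 2) (univ.erase a) := by
      rw [hσ, es_erase l (m + 1) (mem_univ a)]; ring
    rw [← q2, ← hσ, ← hL] at q1
    have q3 : (N ^ 2)⁻¹ ≤ 1 := inv_le_one_of_one_le₀ (one_le_pow₀ hN)
    have q4 : (1 : ℝ) ≤ Fintype.card ι := by exact_mod_cast (by omega : 1 ≤ Fintype.card ι)
    have q5 : 2 * (2 ^ Fintype.card ι * R) ≤ L := by
      have : 0 < 2 ^ Fintype.card ι * R := by positivity
      nlinarith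
    have q6 : L * (σ - L * F a) ≤ L * (σ / 2) := by nlinarith
    linarith [le_of_mul_le_mul_left q6 hL0]
  -- multiply the second order condition by the coefficients and sum
  have hsum : (∑ j, V j * F j) / L + (∑ j, F j * (∑ p, T p j ^ 2 - 2 * T a j ^ 2)) / L ^ 2 +
      ∑ j, F j * (1 - 2 * y j ^ 2) + N * ∑ j, F j * l j ^ 2 + N * ∑ j, W j * F j ≤ 0 := by
    have : ∑ j, F j * (V j / L + (∑ p, T p j ^ 2 - 2 * T a j ^ 2) / L ^ 2 + (1 - 2 * y j ^ 2) +
        N * (l j ^ 2 + W j)) ≤ 0 :=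
      sum_nonpos fun j _ => mul_nonpos_of_nonneg_of_nonpos (hF0 j) (h2 j)
    refine le_trans (le_of_eq ?_) this
    rw [sum_div, sum_div, mul_sum, mul_sum, ← sum_add_distrib, ← sum_add_distrib,
      ← sum_add_distrib, ← sum_add_distrib]
    exact sum_congr rfl fun j _ => by ring
  set X := ∑ j, F j * (∑ p, T p j ^ 2 - 2 * T a j ^ 2)
  set Q := ∑ i, ∑ j ∈ univ.erase i, (T i i * T j j - T i j * T j i) *
    es l m ((univ.erase i).erase j)
  set ψ := ∑ i, T i i * F i with hψ
  -- the gradient terms cancel because of the first order condition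
  have hgrad : (∑ j, γ j * T a j) / L + N * ∑ j, γ j * (l j * v j) = -∑ j, γ j * y j := by
    rw [sum_div, mul_sum, ← sum_add_distrib, ← sum_neg_distrib]
    exact sum_congr rfl fun j _ => by linear_combination γ j * h1 j
  have hTaa : T a a = -(N * L ^ 2 * v a) := by
    have hya : y a = 0 := by
      rcases mul_eq_zero.1 (hly a) with h | h
      · exact absurd h hL0.ne'
      · exact h
    have h := h1 a
    rw [hya, ← hL] at h
    have h' : T a a / L = -(N * (v a * L)) := by linarith only [h]
    rw [div_eq_iff hL0.ne'] at h'
    rw [h']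
    ring
  have hva : v a ^ 2 ≤ A ^ 2 := sq_le_sq' (abs_le.1 hv).1 (abs_le.1 hv).2
  -- the factor `N⁻²` in `hbig` cancels the `N²` coming from `T a a`
  have hA2 : (N ^ 2)⁻¹ * (F a * T a a ^ 2) ≤ A ^ 2 * R * L ^ 3 := by
    rw [hTaa]
    have : (N ^ 2)⁻¹ * (F a * (-(N * L ^ 2 * v a)) ^ 2) = v a ^ 2 * (L * F a) * L ^ 3 := by
      field_simp
    rw [this]
    have : L * F a ≤ R := hFL.trans hσR
    have := mul_nonneg hL0.le (hF0 a)
    gcongr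
  have hψ2 : L * (ψ ^ 2 / σ) ≤ C₄ ^ 2 / μ * L ^ 3 := by
    have p1 : ψ ^ 2 ≤ (C₄ * L) ^ 2 := sq_le_sq' (abs_le.1 h3).1 (abs_le.1 h3).2
    calc L * (ψ ^ 2 / σ) ≤ L * ((C₄ * L) ^ 2 / μ) := by gcongr
      _ = _ := by ring
  have hNF : N * (L * (μ / 2)) ≤ N * ∑ j, F j * l j ^ 2 := by
    refine mul_le_mul_of_nonneg_left ?_ hN0.le
    have p1 : F a * L ^ 2 ≤ ∑ j, F j * l j ^ 2 :=
      single_le_sum (f := fun j => F j * l j ^ 2) (fun j _ => mul_nonneg (hF0 j) (sq_nonneg _))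
        (mem_univ a)
    have p2 : L * (μ / 2) ≤ L * (L * F a) :=
      mul_le_mul_of_nonneg_left (by linarith only [hFL2, hσμ]) hL0.le
    linarith only [p1, p2]
  have hV : -(C₁ * L) + (∑ j, γ j * T a j) / L - Q / L ≤ (∑ j, V j * F j) / L := by
    have : -(C₁ * L) + (∑ j, γ j * T a j) / L - Q / L =
        (-(C₁ * L ^ 2) + ∑ j, γ j * T a j - Q) / L := by field_simp
    rw [this]
    exact div_le_div_of_nonneg_right (by linarith) hL0.le
  have hX : -(C₄ ^ 2 / μ * L) - A ^ 2 * R * L ≤ -(Q / L) + X / L ^ 2 := by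
    have e1 : -(C₄ ^ 2 / μ * L) - A ^ 2 * R * L =
        (-(C₄ ^ 2 / μ * L ^ 3) - A ^ 2 * R * L ^ 3) / L ^ 2 := by field_simp
    have e2 : -(Q / L) + X / L ^ 2 = (-(L * Q) + X) / L ^ 2 := by field_simp
    rw [e1, e2]
    exact div_le_div_of_nonneg_right (by linarith) (by positivity)
  have hW : N * (-C₂) + N * ∑ j, γ j * (l j * v j) ≤ N * ∑ j, W j * F j := by
    rw [← mul_add]
    exact mul_le_mul_of_nonneg_left h5 hN0.le
  have h6' := (abs_le.1 h6).2
  have hC3L : C₃ ≤ C₃ * L := le_mul_of_one_le_right hC₃ hla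
  have hfin := mul_le_mul_of_nonneg_right hNbig hL0.le
  have hpos : 0 ≤ N * μ * L := by positivity
  linarith only [hsum, hgrad, hrad, hNF, hV, hX, hW, h6', hC3L, hfin, hpos]

end EigenvalueBound

section Jets

variable {F : Type*} [NormedAddCommGroup F] [NormedSpace ℝ F]

/-! ### Second order jets of curves -/

/-- The curve `g` is differentiable near `0` and twice differentiable at `0`, with first
derivative `a` and second derivative `b` there. -/
def Jet2 (g : ℝ → F) (a b : F) : Prop :=
  ∃ g' : ℝ → F, (∀ᶠ t in 𝓝 (0 : ℝ), HasDerivAt g (g' t) t) ∧ g' 0 = a ∧ HasDerivAt g' b 0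

theorem Jet2.congr {f g : ℝ → F} {a b : F} (h : Jet2 f a b) (hfg : f =ᶠ[𝓝 0] g) :
    Jet2 g a b := by
  obtain ⟨f', h1, h2, h3⟩ := h
  refine ⟨f', ?_, h2, h3⟩
  filter_upwards [h1, hfg.eventuallyEq_nhds] with t ht ht'
  exact ht.congr_of_eventuallyEq ht'.symm

theorem Jet2.unique {f : ℝ → F} {a b c d : F} (h : Jet2 f a b) (h' : Jet2 f c d) :
    a = c ∧ b = d := by
  obtain ⟨f1, h1, h2, h3⟩ := h
  obtain ⟨g1, k1, k2, k3⟩ := h'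
  have e : f1 =ᶠ[𝓝 0] g1 := by
    filter_upwards [h1, k1] with t p q using p.unique q
  exact ⟨by rw [← h2, ← k2, e.self_of_nhds], h3.unique (k3.congr_of_eventuallyEq e)⟩

theorem Jet2.of_isLocalMax {f : ℝ → ℝ} {a b : ℝ} (h : Jet2 f a b) (hm : IsLocalMax f 0) :
    a = 0 ∧ b ≤ 0 := by
  obtain ⟨f1, h1, rfl, h3⟩ := h
  exact deriv_zero_and_second_nonpos_of_isLocalMax h1 h3 hm

theorem Jet2.const (c : F) : Jet2 (fun _ => c) 0 0 :=
  ⟨fun _ => 0, Eventually.of_forall fun t => hasDerivAt_const t c, rfl, hasDerivAt_const 0 0⟩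

theorem Jet2.line (x v : F) : Jet2 (fun t => x + t • v) v 0 :=
  ⟨fun _ => v, Eventually.of_forall fun t => by
    simpa using ((hasDerivAt_id t).smul_const v).const_add x, rfl, hasDerivAt_const 0 v⟩

theorem Jet2.add {f g : ℝ → F} {a b c d : F} (hf : Jet2 f a b) (hg : Jet2 g c d) :
    Jet2 (fun t => f t + g t) (a + c) (b + d) := by
  obtain ⟨f1, h1, rfl, h3⟩ := hf
  obtain ⟨g1, k1, rfl, k3⟩ := hg
  refine ⟨fun t => f1 t + g1 t, ?_, rfl, h3.add k3⟩
  filter_upwards [h1, k1] with t p q using p.add q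

theorem Jet2.sub {f g : ℝ → F} {a b c d : F} (hf : Jet2 f a b) (hg : Jet2 g c d) :
    Jet2 (fun t => f t - g t) (a - c) (b - d) := by
  obtain ⟨f1, h1, rfl, h3⟩ := hf
  obtain ⟨g1, k1, rfl, k3⟩ := hg
  refine ⟨fun t => f1 t - g1 t, ?_, rfl, h3.sub k3⟩
  filter_upwards [h1, k1] with t p q using p.sub q

theorem Jet2.sum {κ : Type*} [Fintype κ] {f : κ → ℝ → F} {a b : κ → F}
    (h : ∀ i, Jet2 (f i) (a i) (b i)) :
    Jet2 (fun t => ∑ i, f i t) (∑ i, a i) (∑ i, b i) := by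
  choose f1 h1 h2 h3 using h
  refine ⟨fun t => ∑ i, f1 i t, ?_, sum_congr rfl fun i _ => h2 i,
    HasDerivAt.fun_sum fun i _ => h3 i⟩
  filter_upwards [eventually_all.2 h1] with t ht using HasDerivAt.fun_sum fun i _ => ht i

theorem Jet2.smul {f : ℝ → ℝ} {g : ℝ → F} {a b : ℝ} {c d : F} (hf : Jet2 f a b)
    (hg : Jet2 g c d) :
    Jet2 (fun t => f t • g t) (f 0 • c + a • g 0) (f 0 • d + (2 * a) • c + b • g 0) := by
  obtain ⟨f1, h1, rfl, h3⟩ := hf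
  obtain ⟨g1, k1, rfl, k3⟩ := hg
  refine ⟨fun t => f t • g1 t + f1 t • g t, ?_, rfl, ?_⟩
  · filter_upwards [h1, k1] with t p q using p.smul q
  · convert (h1.self_of_nhds.fun_smul k3).fun_add (h3.fun_smul k1.self_of_nhds) using 1
    module

theorem Jet2.mul {f g : ℝ → ℝ} {a b c d : ℝ} (hf : Jet2 f a b) (hg : Jet2 g c d) :
    Jet2 (fun t => f t * g t) (f 0 * c + a * g 0) (f 0 * d + 2 * a * c + b * g 0) :=
  hf.smul hg

theorem Jet2.const_mul {f : ℝ → ℝ} {a b : ℝ} (c : ℝ) (hf : Jet2 f a b) :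
    Jet2 (fun t => c * f t) (c * a) (c * b) := by
  simpa using (Jet2.const c).mul hf

theorem Jet2.sq {f : ℝ → ℝ} {a b : ℝ} (hf : Jet2 f a b) :
    Jet2 (fun t => f t ^ 2) (2 * f 0 * a) (2 * f 0 * b + 2 * a ^ 2) := by
  have := hf.mul hf
  simp only [← pow_two] at this
  have e1 : 2 * f 0 * a = f 0 * a + a * f 0 := by ring
  have e2 : 2 * f 0 * b + 2 * a ^ 2 = f 0 * b + 2 * a * a + b * f 0 := by ring
  rw [e1, e2]
  exact this

theorem Jet2.prodMk {G : Type*} [NormedAddCommGroup G] [NormedSpace ℝ G] {f : ℝ → F} {g : ℝ → G}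
    {a b : F} {c d : G} (hf : Jet2 f a b) (hg : Jet2 g c d) :
    Jet2 (fun t => (f t, g t)) (a, c) (b, d) := by
  obtain ⟨f1, h1, rfl, h3⟩ := hf
  obtain ⟨g1, k1, rfl, k3⟩ := hg
  refine ⟨fun t => (f1 t, g1 t), ?_, rfl, h3.prodMk k3⟩
  filter_upwards [h1, k1] with t p q using p.prodMk q

/-- The chain rule for the composition with a function of one variable. -/
theorem Jet2.comp_real {f φ φ' : ℝ → ℝ} {a b c : ℝ} (hf : Jet2 f a b)
    (h1 : ∀ᶠ s in 𝓝 (f 0), HasDerivAt φ (φ' s) s) (h2 : HasDerivAt φ' c (f 0)) :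
    Jet2 (fun t => φ (f t)) (φ' (f 0) * a) (c * a ^ 2 + φ' (f 0) * b) := by
  obtain ⟨f1, k1, rfl, k3⟩ := hf
  have hcont : Tendsto f (𝓝 0) (𝓝 (f 0)) := k1.self_of_nhds.continuousAt
  refine ⟨fun t => φ' (f t) * f1 t, ?_, rfl, ?_⟩
  · filter_upwards [k1, hcont.eventually h1] with t p q using q.comp t p
  · have := (h2.comp 0 k1.self_of_nhds).fun_mul k3
    rw [show c * f1 0 ^ 2 + φ' (f 0) * b = c * f1 0 * f1 0 + φ' (f 0) * b by ring]
    exact this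

theorem Jet2.log {f : ℝ → ℝ} {a b : ℝ} (hf : Jet2 f a b) (h0 : f 0 ≠ 0) :
    Jet2 (fun t => Real.log (f t)) (a / f 0) (b / f 0 - (a / f 0) ^ 2) := by
  have := hf.comp_real (φ := Real.log) (φ' := fun s => s⁻¹) (c := -(f 0 ^ 2)⁻¹)
    (by filter_upwards [isOpen_ne.mem_nhds h0] with s hs using Real.hasDerivAt_log hs)
    (hasDerivAt_inv h0)
  convert this using 1 <;> field_simp
  ring

/-- Negative powers of a function with value `1` at `0`. -/
theorem Jet2.pow_inv {f : ℝ → ℝ} {a b : ℝ} (hf : Jet2 f a b) (h0 : f 0 = 1) (k : ℕ) :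
    Jet2 (fun t => (f t ^ k)⁻¹) (-(k * a)) (k * (k + 1) * a ^ 2 - k * b) := by
  have hne : f 0 ≠ 0 := by rw [h0]; norm_num
  have hz : ∀ (p : ℤ) (s : ℝ), s ≠ 0 → HasDerivAt (fun x : ℝ => x ^ p) (p * s ^ (p - 1)) s :=
    fun p s hs => hasDerivAt_zpow p s (Or.inl hs)
  have := hf.comp_real (φ := fun s => s ^ (-(k : ℤ)))
    (φ' := fun s => ((-(k : ℤ) : ℤ) : ℝ) * s ^ (-(k : ℤ) - 1))
    (c := ((-(k : ℤ) : ℤ) : ℝ) * (((-(k : ℤ) - 1 : ℤ) : ℝ) * (f 0) ^ (-(k : ℤ) - 1 - 1)))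
    (by filter_upwards [isOpen_ne.mem_nhds hne] with s hs using hz _ s hs)
    ((hz _ _ hne).const_mul _)
  simp only [h0, one_zpow, zpow_neg, zpow_natCast] at this
  convert this using 1 <;> push_cast <;> ring

/-- The chain rule for the composition of a function of class `C²` with a curve. -/
theorem Jet2.comp_contDiffAt {g : F → ℝ} {γ : ℝ → F} {a b : F} (hγ : Jet2 γ a b)
    (hg : ContDiffAt ℝ 2 g (γ 0)) :
    Jet2 (fun t => g (γ t)) (fderiv ℝ g (γ 0) a)
      (fderiv ℝ (fderiv ℝ g) (γ 0) a a + fderiv ℝ g (γ 0) b) := by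
  obtain ⟨γ1, k1, rfl, k3⟩ := hγ
  have hcont : Tendsto γ (𝓝 0) (𝓝 (γ 0)) := k1.self_of_nhds.continuousAt
  have hd : ∀ᶠ y in 𝓝 (γ 0), DifferentiableAt ℝ g y := by
    filter_upwards [hg.eventually (by simp)] with y hy using hy.differentiableAt (by norm_num)
  have h2 : HasFDerivAt (fderiv ℝ g) (fderiv ℝ (fderiv ℝ g) (γ 0)) (γ 0) :=
    ((hg.fderiv_right (m := 1) (by norm_num)).differentiableAt (by norm_num)).hasFDerivAt
  refine ⟨fun t => fderiv ℝ g (γ t) (γ1 t), ?_, rfl, ?_⟩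
  · filter_upwards [k1, hcont.eventually hd] with t p q
    exact q.hasFDerivAt.comp_hasDerivAt t p
  · exact (h2.comp_hasDerivAt 0 k1.self_of_nhds).clm_apply k3

/-- The second order Taylor coefficients of the sum of principal minors, see `minorSum_jet`. -/
theorem Jet2.minorSum {ι : Type*} [Fintype ι] [DecidableEq ι] (m : ℕ) {A : ℝ → Matrix ι ι ℝ}
    {B C : Matrix ι ι ℝ} {l : ι → ℝ} (h0 : A 0 = Matrix.diagonal l)
    (h : ∀ i j, Jet2 (fun t => A t i j) (B i j) (C i j)) :
    Jet2 (fun t => minorSum (m + 2) (A t)) (∑ i, B i i * es l (m + 1) (univ.erase i))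
      (∑ i, C i i * es l (m + 1) (univ.erase i) +
        ∑ i, ∑ j ∈ univ.erase i, (B i i * B j j - B i j * B j i) *
          es l m ((univ.erase i).erase j)) := by
  choose A1 h1 h2 h3 using h
  obtain ⟨D, hD1, hD2, hD3⟩ := minorSum_jet m (A1 := fun t i j => A1 i j t) (A2 := C) h0 h1 h3
  simp only [h2] at hD2 hD3
  exact ⟨D, hD1, hD2, hD3⟩

end Jets

section DirectionalDerivatives

variable {E : Type*} [NormedAddCommGroup E] [NormedSpace ℝ E]

/-! ### Directional derivatives on a punctured space -/

/-- The derivative of `f` in the direction `v`, as a function of the base point. -/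
def pd (v : E) (f : E → ℝ) (y : E) : ℝ := fderiv ℝ f y v

theorem pd_contDiffOn {f : E → ℝ} (hf : ContDiffOn ℝ ∞ f {0}ᶜ) (v : E) :
    ContDiffOn ℝ ∞ (pd v f) {0}ᶜ := by
  have : ContDiffOn ℝ ∞ (fderiv ℝ f) {0}ᶜ :=
    hf.fderiv_of_isOpen isOpen_compl_singleton (by simp)
  exact this.clm_apply contDiffOn_const

theorem contDiffAt_of_ne {f : E → ℝ} (hf : ContDiffOn ℝ ∞ f {0}ᶜ) {y : E} (hy : y ≠ 0) :
    ContDiffAt ℝ ∞ f y :=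
  hf.contDiffAt (isOpen_compl_singleton.mem_nhds hy)

theorem differentiableAt_of_ne {f : E → ℝ} (hf : ContDiffOn ℝ ∞ f {0}ᶜ) {y : E} (hy : y ≠ 0) :
    DifferentiableAt ℝ f y :=
  (contDiffAt_of_ne hf hy).differentiableAt (by simp)

theorem pd_comm {f : E → ℝ} (hf : ContDiffOn ℝ ∞ f {0}ᶜ) (v w : E) {y : E} (hy : y ≠ 0) :
    pd v (pd w f) y = pd w (pd v f) y := by
  have h := contDiffAt_of_ne hf hy
  have hd : DifferentiableAt ℝ (fderiv ℝ f) y :=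
    (h.fderiv_right (m := 1) (by norm_cast)).differentiableAt (by norm_num)
  have e : ∀ v w : E, pd v (pd w f) y = fderiv ℝ (fderiv ℝ f) y v w := by
    intro v w
    unfold pd
    rw [fderiv_clm_apply hd (differentiableAt_const w)]
    simp
  rw [e, e]
  exact (h.isSymmSndFDerivAt (by simp; exact WithTop.coe_le_coe.2 le_top)) v w

theorem pd_congr {f g : E → ℝ} (h : ∀ y, y ≠ 0 → f y = g y) (v : E) {y : E} (hy : y ≠ 0) :
    pd v f y = pd v g y := by
  have : f =ᶠ[𝓝 y] g := by
    filter_upwards [isOpen_compl_singleton.mem_nhds hy] with z hz using h z hz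
  unfold pd
  rw [this.fderiv_eq]

theorem pd_sum_smul {κ : Type*} [Fintype κ] (f : E → ℝ) (c : κ → ℝ) (b : κ → E) (y : E) :
    pd (∑ i, c i • b i) f y = ∑ i, c i * pd (b i) f y := by
  simp [pd, map_sum]

theorem Jet2.of_pd {f : E → ℝ} (hf : ContDiffOn ℝ ∞ f {0}ᶜ) {x : E} (hx : x ≠ 0) (v : E) :
    Jet2 (fun t : ℝ => f (x + t • v)) (pd v f x) (pd v (pd v f) x) := by
  have hline : ∀ t : ℝ, HasDerivAt (fun t : ℝ => x + t • v) v t := fun t => by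
    simpa using ((hasDerivAt_id t).smul_const v).const_add x
  have key : ∀ {g : E → ℝ}, ContDiffOn ℝ ∞ g {0}ᶜ → ∀ t : ℝ, x + t • v ≠ 0 →
      HasDerivAt (fun t : ℝ => g (x + t • v)) (pd v g (x + t • v)) t := fun hg t ht =>
    (differentiableAt_of_ne hg ht).hasFDerivAt.comp_hasDerivAt t (hline t)
  have hne : ∀ᶠ t : ℝ in 𝓝 0, x + t • v ≠ 0 := by
    have : ContinuousAt (fun t : ℝ => x + t • v) 0 := (hline 0).continuousAt
    exact this.eventually_ne (by simpa using hx)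
  refine ⟨fun t => pd v f (x + t • v), ?_, by simp, ?_⟩
  · filter_upwards [hne] with t ht using key hf t ht
  · simpa using key (pd_contDiffOn hf v) 0 (by simpa using hx)

/-- Derivatives of homogeneous functions are homogeneous. -/
theorem pd_homogeneous {f : E → ℝ} (hf : ContDiffOn ℝ ∞ f {0}ᶜ) {r c : ℝ} (hr : r ≠ 0)
    (h : ∀ y, y ≠ 0 → f (r • y) = c * f y) (v : E) {y : E} (hy : y ≠ 0) :
    pd v f (r • y) = r⁻¹ * c * pd v f y := by
  have hry : r • y ≠ 0 := smul_ne_zero hr hy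
  have h1 : HasFDerivAt (fun z => f (r • z))
      ((fderiv ℝ f (r • y)).comp (r • ContinuousLinearMap.id ℝ E)) y :=
    HasFDerivAt.comp y (differentiableAt_of_ne hf hry).hasFDerivAt
      ((hasFDerivAt_id y).const_smul r)
  have h2 : HasFDerivAt (fun z => f (r • z)) (c • fderiv ℝ f y) y := by
    refine ((differentiableAt_of_ne hf hy).hasFDerivAt.const_mul c).congr_of_eventuallyEq ?_
    filter_upwards [isOpen_compl_singleton.mem_nhds hy] with z hz using h z hz
  have h3 := congrArg (fun L : E →L[ℝ] ℝ => L v) (h1.unique h2)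
  simp only [ContinuousLinearMap.comp_apply, smul_apply,
    ContinuousLinearMap.id_apply, map_smul, smul_eq_mul] at h3
  unfold pd
  rw [mul_assoc, ← h3]
  field_simp

/-- Euler's identity for a function whose restriction to a ray is affine. -/
theorem pd_radial {f : E → ℝ} (hf : ContDiffOn ℝ ∞ f {0}ᶜ) {y : E} (hy : y ≠ 0) {c d : ℝ}
    (h : ∀ r : ℝ, 0 < r → f (r • y) = c + d * r) : pd y f y = d := by
  have h1 : HasDerivAt (fun t : ℝ => f (t • y)) (pd y f y) 1 := by
    have h0 : DifferentiableAt ℝ f ((1 : ℝ) • y) := by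
      rw [one_smul]; exact differentiableAt_of_ne hf hy
    have := h0.hasFDerivAt.comp_hasDerivAt (1 : ℝ) ((hasDerivAt_id (1 : ℝ)).smul_const y)
    simpa [pd, Function.comp_def] using this
  have h2 : HasDerivAt (fun t : ℝ => f (t • y)) d 1 := by
    have : HasDerivAt (fun t : ℝ => c + d * t) d 1 := by
      simpa using ((hasDerivAt_id (1 : ℝ)).const_mul d).const_add c
    refine this.congr_of_eventuallyEq ?_
    filter_upwards [isOpen_Ioi.mem_nhds (show (1 : ℝ) ∈ Set.Ioi 0 by simp)] with t ht
      using h t ht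
  exact h1.unique h2

end DirectionalDerivatives

section Norm

variable {E : Type*} [NormedAddCommGroup E] [InnerProductSpace ℝ E]

theorem contDiffOn_norm_compl_zero : ContDiffOn ℝ ∞ (fun y : E => ‖y‖) {0}ᶜ :=
  fun _ hy => (contDiffAt_norm ℝ hy).contDiffWithinAt

theorem pd_norm (v : E) {y : E} (hy : y ≠ 0) : pd v (fun y : E => ‖y‖) y = ⟪y, v⟫ * ‖y‖⁻¹ := by
  have h1 : HasFDerivAt (fun y : E => ‖y‖ ^ 2) (2 • innerSL ℝ y) y :=
    (hasStrictFDerivAt_norm_sq y).hasFDerivAt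
  have h2 := (differentiableAt_of_ne contDiffOn_norm_compl_zero hy).hasFDerivAt.pow 2
  have h3 := congrArg (fun L : E →L[ℝ] ℝ => L v) (h1.unique h2)
  have h0 : ‖y‖ ≠ 0 := norm_ne_zero_iff.2 hy
  simp at h3
  unfold pd
  field_simp
  linarith

theorem pd_pd_norm (v w : E) {y : E} (hy : ‖y‖ = 1) :
    pd v (pd w (fun y : E => ‖y‖)) y = ⟪v, w⟫ - ⟪y, v⟫ * ⟪y, w⟫ := by
  have hy0 : y ≠ 0 := by
    rintro rfl
    simp at hy
  rw [pd_congr (fun z hz => pd_norm w hz) v hy0]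
  have h1 : HasFDerivAt (fun z : E => ⟪z, w⟫) (innerSL ℝ w) y := by
    have := (innerSL ℝ w).hasFDerivAt (x := y)
    refine this.congr_of_eventuallyEq (Eventually.of_forall fun z => ?_)
    simp [real_inner_comm]
  have h2 : HasFDerivAt (fun z : E => ‖z‖) (fderiv ℝ (fun z : E => ‖z‖) y) y :=
    (differentiableAt_of_ne contDiffOn_norm_compl_zero hy0).hasFDerivAt
  have h3 := (h1.fun_mul ((hasDerivAt_inv (norm_ne_zero_iff.2 hy0)).comp_hasFDerivAt y h2)).fderiv
  simp only [Function.comp_def] at h3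
  unfold pd
  rw [h3]
  have h4 := pd_norm v hy0
  unfold pd at h4
  simp [h4, hy, real_inner_comm]
  ring

theorem Jet2.norm_line {x : E} (hx : ‖x‖ = 1) (v : E) :
    Jet2 (fun t : ℝ => ‖x + t • v‖) ⟪x, v⟫ (‖v‖ ^ 2 - ⟪x, v⟫ ^ 2) := by
  have hx0 : x ≠ 0 := by
    rintro rfl
    simp at hx
  have := Jet2.of_pd (contDiffOn_norm_compl_zero (E := E)) hx0 v
  rw [pd_norm v hx0, pd_pd_norm v v hx, hx, real_inner_self_eq_norm_sq] at this
  convert this using 1 <;> ring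

end Norm

section MaximumPrinciple

variable {E : Type*} [NormedAddCommGroup E] [InnerProductSpace ℝ E]

/-! ### The equation and the test function at a maximum -/

theorem pd_third_symm {u : E → ℝ} (hu : ContDiffOn ℝ ∞ u {0}ᶜ) (v w z : E) {y : E} (hy : y ≠ 0) :
    pd v (pd w (pd z u)) y = pd v (pd z (pd w u)) y :=
  pd_congr (fun _ hx => pd_comm hu w z hx) v hy

theorem pd_third_rotate {u : E → ℝ} (hu : ContDiffOn ℝ ∞ u {0}ᶜ) (v w z : E) {y : E}
    (hy : y ≠ 0) : pd v (pd w (pd z u)) y = pd z (pd w (pd v u)) y := by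
  rw [pd_third_symm hu v w z hy, pd_comm (pd_contDiffOn hu w) v z hy, pd_third_symm hu z v w hy]

theorem pd_fourth_symm {u : E → ℝ} (hu : ContDiffOn ℝ ∞ u {0}ᶜ) (v w : E) {y : E} (hy : y ≠ 0) :
    pd v (pd v (pd w (pd w u))) y = pd w (pd w (pd v (pd v u))) y := by
  have h1 : pd v (pd v (pd w (pd w u))) y = pd v (pd w (pd v (pd w u))) y :=
    pd_congr (fun _ hx => pd_comm (pd_contDiffOn hu w) v w hx) v hy
  have h2 : pd v (pd w (pd v (pd w u))) y = pd w (pd v (pd v (pd w u))) y :=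
    pd_comm (pd_contDiffOn (pd_contDiffOn hu w) v) v w hy
  have h3 : pd w (pd v (pd v (pd w u))) y = pd w (pd w (pd v (pd v u))) y :=
    pd_congr (fun x hx => by
      rw [pd_third_symm hu v v w hx, pd_comm (pd_contDiffOn hu v) v w hx]) w hy
  rw [h1, h2, h3]

variable {ι : Type*} [Fintype ι]

/-- The gradient of `u` in an orthonormal basis. -/
def gradB (b : OrthonormalBasis ι ℝ E) (u : E → ℝ) (y : E) : E := ∑ i, pd (b i) u y • b i

theorem inner_gradB (b : OrthonormalBasis ι ℝ E) (u : E → ℝ) (y w : E) :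
    ⟪gradB b u y, w⟫ = pd w u y := by
  have h := b.sum_repr' w
  unfold gradB
  rw [sum_inner]
  conv_rhs => rw [← h, pd_sum_smul]
  refine sum_congr rfl fun i _ => ?_
  rw [real_inner_smul_left, mul_comm]

theorem norm_gradB_sq (b : OrthonormalBasis ι ℝ E) (u : E → ℝ) (y : E) :
    ‖gradB b u y‖ ^ 2 = ∑ i, pd (b i) u y ^ 2 := by
  rw [← real_inner_self_eq_norm_sq, inner_gradB]
  unfold gradB
  rw [pd_sum_smul]
  exact sum_congr rfl fun i _ => by ring

/-- The matrix of second derivatives of `u` in an orthonormal basis. -/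
def hessB (b : OrthonormalBasis ι ℝ E) (u : E → ℝ) (y : E) : Matrix ι ι ℝ :=
  Matrix.of fun i j => pd (b i) (pd (b j) u) y

/-- The point `(y, z, q)` at which the right-hand side of the equation is evaluated when `u` is
the homogeneous extension of `h`; on the unit sphere it is `(x, h, ∇h)`. The exponent `1` gives
both powers of the norm the shape of `Jet2.pow_inv`. -/
def eqPoint (b : OrthonormalBasis ι ℝ E) (u : E → ℝ) (y : E) : E × ℝ × E :=
  (y, (‖y‖ ^ 1)⁻¹ * u y, gradB b u y - ((‖y‖ ^ 2)⁻¹ * u y) • y)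

/-- The second order jet of `eqPoint` along a line through a point of the unit sphere. -/
theorem Jet2.eqPoint (b : OrthonormalBasis ι ℝ E) {u : E → ℝ} (hu : ContDiffOn ℝ ∞ u {0}ᶜ)
    {x : E} (hx : ‖x‖ = 1) (v : E) :
    Jet2 (fun t : ℝ => eqPoint b u (x + t • v))
      (v, pd v u x - ⟪x, v⟫ * u x, ∑ i, pd v (pd (b i) u) x • b i -
        (u x • v + (pd v u x - 2 * ⟪x, v⟫ * u x) • x))
      (0, pd v (pd v u) x - 2 * ⟪x, v⟫ * pd v u x + (3 * ⟪x, v⟫ ^ 2 - ‖v‖ ^ 2) * u x,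
        ∑ i, pd v (pd v (pd (b i) u)) x • b i -
        ((2 * (pd v u x - 2 * ⟪x, v⟫ * u x)) • v +
          (pd v (pd v u) x - 4 * ⟪x, v⟫ * pd v u x +
            (8 * ⟪x, v⟫ ^ 2 - 2 * ‖v‖ ^ 2) * u x) • x)) := by
  have hx0 : x ≠ 0 := by
    rintro rfl
    simp at hx
  have hn := Jet2.norm_line hx v
  have hn0 : ‖x + (0 : ℝ) • v‖ = 1 := by simpa using hx
  have hU := Jet2.of_pd hu hx0 v
  have hz := (hn.pow_inv hn0 1).mul hU
  have hκ := (hn.pow_inv hn0 2).mul hU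
  have hq := (Jet2.sum fun i => (Jet2.of_pd (pd_contDiffOn hu (b i)) hx0 v).smul
    (Jet2.const (b i))).sub (hκ.smul (Jet2.line x v))
  have := (Jet2.line x v).prodMk (hz.prodMk hq)
  simp only [zero_smul, add_zero, hx, one_pow, inv_one, one_mul, smul_zero, zero_add] at this
  simp only [Nat.cast_one, Nat.cast_ofNat] at this
  have z1 : pd v u x - ⟪x, v⟫ * u x = pd v u x + -(1 * ⟪x, v⟫) * u x := by ring
  have z2 : pd v (pd v u) x - 2 * ⟪x, v⟫ * pd v u x + (3 * ⟪x, v⟫ ^ 2 - ‖v‖ ^ 2) * u x =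
      pd v (pd v u) x + 2 * -(1 * ⟪x, v⟫) * pd v u x +
        (1 * (1 + 1) * ⟪x, v⟫ ^ 2 - 1 * (‖v‖ ^ 2 - ⟪x, v⟫ ^ 2)) * u x := by ring
  have k1 : pd v u x - 2 * ⟪x, v⟫ * u x = pd v u x + -(2 * ⟪x, v⟫) * u x := by ring
  have k2 : pd v (pd v u) x - 4 * ⟪x, v⟫ * pd v u x + (8 * ⟪x, v⟫ ^ 2 - 2 * ‖v‖ ^ 2) * u x =
      pd v (pd v u) x + 2 * -(2 * ⟪x, v⟫) * pd v u x +
        (2 * (2 + 1) * ⟪x, v⟫ ^ 2 - 2 * (‖v‖ ^ 2 - ⟪x, v⟫ ^ 2)) * u x := by ring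
  rw [z1, z2, k1, k2]
  exact this

variable [DecidableEq ι]

/-- The equation, differentiated once and twice in the direction `v` at a point where the Hessian
is diagonal. -/
theorem equation_derivatives (m : ℕ) (b : OrthonormalBasis ι ℝ E) {u : E → ℝ}
    (hu : ContDiffOn ℝ ∞ u {0}ᶜ) {g : E × ℝ × E → ℝ}
    (heq : ∀ y, y ≠ 0 → minorSum (m + 2) (hessB b u y) = (‖y‖ ^ (m + 2))⁻¹ * g (eqPoint b u y))
    {x : E} (hx : ‖x‖ = 1) (hg : ContDiffAt ℝ 2 g (eqPoint b u x)) {l : ι → ℝ}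
    (hl : hessB b u x = Matrix.diagonal l) {v : E} {a₁ a₂ : E × ℝ × E}
    (hγ : Jet2 (fun t : ℝ => eqPoint b u (x + t • v)) a₁ a₂) :
    ∑ i, pd v (pd (b i) (pd (b i) u)) x * es l (m + 1) (univ.erase i) =
      fderiv ℝ g (eqPoint b u x) a₁ - (m + 2) * ⟪x, v⟫ * g (eqPoint b u x) ∧
    ∑ i, pd v (pd v (pd (b i) (pd (b i) u))) x * es l (m + 1) (univ.erase i) +
        ∑ i, ∑ j ∈ univ.erase i, (pd v (pd (b i) (pd (b i) u)) x * pd v (pd (b j) (pd (b j) u)) x -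
          pd v (pd (b i) (pd (b j) u)) x * pd v (pd (b j) (pd (b i) u)) x) *
          es l m ((univ.erase i).erase j) =
      fderiv ℝ (fderiv ℝ g) (eqPoint b u x) a₁ a₁ + fderiv ℝ g (eqPoint b u x) a₂ -
        2 * (m + 2) * ⟪x, v⟫ * fderiv ℝ g (eqPoint b u x) a₁ +
        ((m + 2) * (m + 3) * ⟪x, v⟫ ^ 2 - (m + 2) * (‖v‖ ^ 2 - ⟪x, v⟫ ^ 2)) *
          g (eqPoint b u x) := by
  have hx0 : x ≠ 0 := by
    rintro rfl
    simp at hx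
  have hn := Jet2.norm_line hx v
  have hn0 : ‖x + (0 : ℝ) • v‖ = 1 := by simpa using hx
  have hP : eqPoint b u (x + (0 : ℝ) • v) = eqPoint b u x := by simp
  have hR := (hn.pow_inv hn0 (m + 2)).mul (hγ.comp_contDiffAt (g := g) (by rw [hP]; exact hg))
  have hL := Jet2.minorSum m (A := fun t : ℝ => hessB b u (x + t • v))
    (B := Matrix.of fun i j => pd v (pd (b i) (pd (b j) u)) x)
    (C := Matrix.of fun i j => pd v (pd v (pd (b i) (pd (b j) u))) x) (l := l)
    (by simpa using hl)
    (fun i j => Jet2.of_pd (pd_contDiffOn (pd_contDiffOn hu (b j)) (b i)) hx0 v)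
  have hev : (fun t : ℝ => minorSum (m + 2) (hessB b u (x + t • v))) =ᶠ[𝓝 0]
      fun t => (‖x + t • v‖ ^ (m + 2))⁻¹ * g (eqPoint b u (x + t • v)) := by
    have hc : ContinuousAt (fun t : ℝ => x + t • v) 0 := by fun_prop
    filter_upwards [hc.eventually_ne (y := 0) (by simpa using hx0)] with t ht using heq _ ht
  have hfin := (hL.congr hev).unique hR
  simp only [hP, hn0, one_pow, inv_one, one_mul, Matrix.of_apply] at hfin
  refine ⟨hfin.1.trans ?_, hfin.2.trans ?_⟩
  · push_cast; ring
  · push_cast; ring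

/-- The test function `½ log |D²u e|² + log |y| + N/2 |Du|²` of the maximum principle, for a fixed
direction `e`. The term `log |y|` makes it homogeneous of degree `0` when `u` is homogeneous of
degree one, so that a maximum on the sphere is a maximum on the punctured space. -/
def testFn (b : OrthonormalBasis ι ℝ E) (u : E → ℝ) (N : ℝ) (e y : E) : ℝ :=
  1 / 2 * Real.log (∑ p, pd (b p) (pd e u) y ^ 2) + Real.log ‖y‖ +
    N / 2 * ∑ p, pd (b p) u y ^ 2

/-- The first and second order conditions at a maximum of the test function, in a direction of
the eigenbasis. -/
theorem testFn_conditions (b : OrthonormalBasis ι ℝ E) {u : E → ℝ} (hu : ContDiffOn ℝ ∞ u {0}ᶜ)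
    {x : E} (hx : ‖x‖ = 1) {l : ι → ℝ} (hl : hessB b u x = Matrix.diagonal l) (a : ι)
    (hla : l a ≠ 0) (N : ℝ) (hmax : IsLocalMax (testFn b u N (b a)) x) (j : ι) :
    pd (b j) (pd (b a) (pd (b a) u)) x / l a + ⟪x, b j⟫ + N * (pd (b j) u x * l j) = 0 ∧
    pd (b j) (pd (b j) (pd (b a) (pd (b a) u))) x / l a +
      (∑ p, pd (b j) (pd (b p) (pd (b a) u)) x ^ 2 -
        2 * pd (b j) (pd (b a) (pd (b a) u)) x ^ 2) / l a ^ 2 + (1 - 2 * ⟪x, b j⟫ ^ 2) +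
      N * (l j ^ 2 + ∑ p, pd (b p) u x * pd (b j) (pd (b j) (pd (b p) u)) x) ≤ 0 := by
  have hx0 : x ≠ 0 := by
    rintro rfl
    simp at hx
  have hij : ∀ p q, pd (b p) (pd (b q) u) x = if p = q then l p else 0 := by
    intro p q
    have := congrFun (congrFun hl p) q
    simpa [hessB, Matrix.diagonal_apply] using this
  have hn0 : ‖x + (0 : ℝ) • b j‖ = 1 := by simpa using hx
  have hQ := Jet2.sum fun p =>
    (Jet2.of_pd (pd_contDiffOn (pd_contDiffOn hu (b a)) (b p)) hx0 (b j)).sq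
  have hK := Jet2.sum fun p => (Jet2.of_pd (pd_contDiffOn hu (b p)) hx0 (b j)).sq
  have hQ0 : ∑ p, pd (b p) (pd (b a) u) x ^ 2 = l a ^ 2 := by
    simp [hij]
  have hlog := hQ.log (by simp only [zero_smul, add_zero, hQ0]; exact pow_ne_zero 2 hla)
  have hJ := ((hlog.const_mul (1 / 2)).add ((Jet2.norm_line hx (b j)).log
    (by rw [hn0]; norm_num))).add (hK.const_mul (N / 2))
  have hc : Tendsto (fun t : ℝ => x + t • b j) (𝓝 0) (𝓝 x) := by
    have : ContinuousAt (fun t : ℝ => x + t • b j) 0 := by fun_prop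
    simpa [ContinuousAt] using this
  have hm : IsLocalMax (fun t : ℝ => testFn b u N (b a) (x + t • b j)) 0 := by
    have := hc.eventually hmax
    simpa [IsLocalMax, IsMaxFilter] using this
  obtain ⟨r1, r2⟩ := hJ.of_isLocalMax hm
  simp only [zero_smul, add_zero, hQ0, hx] at r1 r2
  have s1 : ∑ p, 2 * pd (b p) (pd (b a) u) x * pd (b j) (pd (b p) (pd (b a) u)) x =
      2 * l a * pd (b j) (pd (b a) (pd (b a) u)) x := by
    simp [hij]
  have s2 : ∑ p, 2 * pd (b p) u x * pd (b j) (pd (b p) u) x = 2 * (pd (b j) u x * l j) := by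
    simp [hij]
    ring
  have s3 : ∑ p, (2 * pd (b p) (pd (b a) u) x * pd (b j) (pd (b j) (pd (b p) (pd (b a) u))) x +
      2 * pd (b j) (pd (b p) (pd (b a) u)) x ^ 2) =
      2 * l a * pd (b j) (pd (b j) (pd (b a) (pd (b a) u))) x +
        2 * ∑ p, pd (b j) (pd (b p) (pd (b a) u)) x ^ 2 := by
    rw [sum_add_distrib, mul_sum]
    simp [hij]
  have s4 : ∑ p, (2 * pd (b p) u x * pd (b j) (pd (b j) (pd (b p) u)) x +
      2 * pd (b j) (pd (b p) u) x ^ 2) =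
      2 * (l j ^ 2 + ∑ p, pd (b p) u x * pd (b j) (pd (b j) (pd (b p) u)) x) := by
    rw [sum_add_distrib, mul_add, mul_sum, add_comm]
    congr 1
    · simp [hij]
    · exact sum_congr rfl fun p _ => by ring
  have hbj : ‖b j‖ = 1 := b.norm_eq_one j
  rw [s1, s2] at r1
  rw [s1, s3, s4, hbj] at r2
  constructor
  · rw [← r1]
    field_simp
  · refine le_trans (le_of_eq ?_) r2
    field_simp
    ring

end MaximumPrinciple

section LocalEstimate

/-! ### The eigenvalue bound at a maximum -/

theorem norm_prod_le {E : Type*} [NormedAddCommGroup E] {p q : E} {z r : ℝ} (hp : ‖p‖ ≤ r)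
    (hz : |z| ≤ r) (hq : ‖q‖ ≤ r) :
    ‖((p, z, q) : E × ℝ × E)‖ ≤ r := by
  rw [Prod.norm_def, Prod.norm_def]
  exact max_le hp (max_le hz hq)

variable {E : Type*} [NormedAddCommGroup E] [InnerProductSpace ℝ E]
variable {ι : Type*} [Fintype ι]

theorem pd_self_of_homogeneous {u : E → ℝ} (hu : ContDiffOn ℝ ∞ u {0}ᶜ)
    (hhom : ∀ r : ℝ, 0 < r → ∀ y, y ≠ 0 → u (r • y) = r * u y) {x : E} (hx : x ≠ 0) :
    pd x u x = u x :=
  pd_radial hu hx (c := 0) fun r hr => by rw [hhom r hr x hx]; ring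

theorem pd_smul_of_homogeneous {u : E → ℝ} (hu : ContDiffOn ℝ ∞ u {0}ᶜ)
    (hhom : ∀ r : ℝ, 0 < r → ∀ y, y ≠ 0 → u (r • y) = r * u y) (v : E) {r : ℝ} (hr : 0 < r)
    {y : E} (hy : y ≠ 0) : pd v u (r • y) = pd v u y := by
  rw [pd_homogeneous hu hr.ne' (hhom r hr) v hy, inv_mul_cancel₀ hr.ne', one_mul]

theorem pd_pd_smul_of_homogeneous {u : E → ℝ} (hu : ContDiffOn ℝ ∞ u {0}ᶜ)
    (hhom : ∀ r : ℝ, 0 < r → ∀ y, y ≠ 0 → u (r • y) = r * u y) (v w : E) {r : ℝ} (hr : 0 < r)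
    {y : E} (hy : y ≠ 0) : pd v (pd w u) (r • y) = r⁻¹ * pd v (pd w u) y := by
  rw [pd_homogeneous (pd_contDiffOn hu w) hr.ne' (c := 1)
    (fun z hz => by rw [pd_smul_of_homogeneous hu hhom w hr hz, one_mul]) v hy, mul_one]

theorem pd_self_pd_of_homogeneous {u : E → ℝ} (hu : ContDiffOn ℝ ∞ u {0}ᶜ)
    (hhom : ∀ r : ℝ, 0 < r → ∀ y, y ≠ 0 → u (r • y) = r * u y) (v : E) {x : E} (hx : x ≠ 0) :
    pd x (pd v u) x = 0 :=
  pd_radial (pd_contDiffOn hu v) hx (c := pd v u x) fun r hr => by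
    rw [pd_smul_of_homogeneous hu hhom v hr hx]; ring

theorem pd_basis_expansion (b : OrthonormalBasis ι ℝ E) (f : E → ℝ) (v y : E) :
    pd v f y = ∑ i, ⟪v, b i⟫ * pd (b i) f y := by
  conv_lhs => rw [← b.sum_repr' v, pd_sum_smul]
  exact sum_congr rfl fun i _ => by rw [real_inner_comm]

variable [DecidableEq ι]

set_option maxHeartbeats 1000000 in
/-- The bound for the largest eigenvalue of the Hessian at a maximum of the test function. -/
theorem eigenvalue_le_of_isLocalMax (m : ℕ) (hm : m + 3 ≤ Fintype.card ι)
    (b : OrthonormalBasis ι ℝ E) {u : E → ℝ} (hu : ContDiffOn ℝ ∞ u {0}ᶜ)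
    (hhom : ∀ r : ℝ, 0 < r → ∀ y, y ≠ 0 → u (r • y) = r * u y) {g : E × ℝ × E → ℝ}
    (heq : ∀ y, y ≠ 0 → minorSum (m + 2) (hessB b u y) = (‖y‖ ^ (m + 2))⁻¹ * g (eqPoint b u y))
    {x : E} (hx : ‖x‖ = 1) (hg : ContDiffAt ℝ 2 g (eqPoint b u x)) {A B μ R N : ℝ}
    (hA : 0 ≤ A) (hB : 0 ≤ B) (hux : |u x| ≤ A) (hgrad : ‖gradB b u x‖ ≤ A)
    (hg0 : |g (eqPoint b u x)| ≤ B) (hg1 : ‖fderiv ℝ g (eqPoint b u x)‖ ≤ B)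
    (hg2 : ∀ a, |fderiv ℝ (fderiv ℝ g) (eqPoint b u x) a a| ≤ B * ‖a‖ ^ 2)
    {l : ι → ℝ} (hdiag : hessB b u x = Matrix.diagonal l) (hl : ∀ i, 0 ≤ l i) (a : ι)
    (hla : 1 ≤ l a) (hR : 1 ≤ R) (hBR : B ≤ R) (hμ : 0 < μ) (hgμ : μ ≤ g (eqPoint b u x))
    (hN : 1 ≤ N)
    (hbig : 18 * Fintype.card ι * (2 ^ Fintype.card ι * R) ≤ (N ^ 2)⁻¹ * l a)
    (hNbig : (B * (1 + 2 * A) ^ 2 + B * (1 + 4 * A) + (m + 2) * B) + B +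
      (B * (1 + 2 * A)) ^ 2 / μ + A ^ 2 * R + 1 ≤ N * μ / 4)
    (hmax : IsLocalMax (testFn b u N (b a)) x) :
    l a ≤ N * ((m + 2) * A * B + B * (A + 4 * A ^ 2)) := by
  have hx0 : x ≠ 0 := by
    rintro rfl
    simp at hx
  have hla0 : 0 < l a := by linarith
  have hij : ∀ p q, pd (b p) (pd (b q) u) x = if p = q then l p else 0 := by
    intro p q
    have := congrFun (congrFun hdiag p) q
    simpa [hessB, Matrix.diagonal_apply] using this
  set P := eqPoint b u x with hP
  set D := fderiv ℝ g P with hD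
  have hDle : ∀ p : E × ℝ × E, |D p| ≤ B * ‖p‖ := fun p =>
    (D.le_opNorm p).trans (mul_le_mul_of_nonneg_right hg1 (norm_nonneg p))
  have hDle' : ∀ (p : E × ℝ × E) {r : ℝ}, ‖p‖ ≤ r → |D p| ≤ B * r := fun p r hr =>
    (hDle p).trans (mul_le_mul_of_nonneg_left hr hB)
  have hσ : es l (m + 2) univ = g P := by
    have := heq x hx0
    rw [hdiag, minorSum_diagonal, hx] at this
    simpa using this
  have hly : ∀ j, l j * ⟪x, b j⟫ = 0 := by
    intro j
    have h1 := pd_self_pd_of_homogeneous hu hhom (b j) hx0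
    rw [pd_basis_expansion b _ x] at h1
    simpa [hij, mul_comm] using h1
  have hy : ∑ j, ⟪x, b j⟫ ^ 2 = 1 := by
    have := b.sum_sq_inner_right x
    rw [hx] at this
    simpa [real_inner_comm] using this
  have hxa : ⟪x, b a⟫ = 0 := by
    rcases mul_eq_zero.1 (hly a) with h | h
    · exact absurd h hla0.ne'
    · exact h
  have hba : ‖b a‖ = 1 := b.norm_eq_one a
  have hva : |pd (b a) u x| ≤ A := by
    rw [← inner_gradB b]
    calc |⟪gradB b u x, b a⟫| ≤ ‖gradB b u x‖ * ‖b a‖ := abs_real_inner_le_norm _ _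
      _ ≤ A := by rw [hba, mul_one]; exact hgrad
  set w := gradB b u x with hw
  have hwx : ⟪x, w⟫ = u x := by
    rw [real_inner_comm, hw, inner_gradB, pd_self_of_homogeneous hu hhom hx0]
  have hpdw : pd w u x = ‖w‖ ^ 2 := by
    rw [← inner_gradB b, ← hw, real_inner_self_eq_norm_sq]
  -- the equation, differentiated in the direction `b a`
  have ea := equation_derivatives m b hu heq hx hg hdiag (Jet2.eqPoint b hu hx (b a))
  have hsum1 : ∑ i, pd (b a) (pd (b i) u) x • b i = l a • b a := by
    simp [hij]
  rw [hsum1, hxa, hba] at ea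
  have hDsum : ∀ c : ι → ℝ, D (0, 0, ∑ i, c i • b i) = ∑ i, D (0, 0, b i) * c i := by
    intro c
    have : ((0, 0, ∑ i, c i • b i) : E × ℝ × E) = ∑ i, c i • ((0, 0, b i) : E × ℝ × E) := by
      simp [Prod.ext_iff, Prod.fst_sum, Prod.snd_sum]
    rw [this, map_sum]
    exact sum_congr rfl fun i _ => by rw [map_smul, smul_eq_mul, mul_comm]
  -- the equation, differentiated in the direction of the gradient
  have ew := (equation_derivatives m b hu heq hx hg hdiag (Jet2.eqPoint b hu hx w)).1
  have hsumw : ∑ i, pd w (pd (b i) u) x • b i = ∑ i, (l i * pd (b i) u x) • b i := by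
    refine sum_congr rfl fun i _ => ?_
    congr 1
    rw [hw, gradB, pd_sum_smul]
    simp [hij, mul_comm]
  rw [hsumw, hwx, hpdw] at ew
  have hux2 := abs_le.1 hux
  have hva2 := abs_le.1 hva
  have hAla : A ≤ A * l a := le_mul_of_one_le_right hA hla
  -- the first derivative of `eqPoint` along `b a`; the factors `0` stand for `⟪x, b a⟫`
  set a₁ : E × ℝ × E := (b a, pd (b a) u x - 0 * u x,
    l a • b a - (u x • b a + (pd (b a) u x - 2 * 0 * u x) • x)) with ha₁
  have hn1 : ‖a₁‖ ≤ (1 + 2 * A) * l a := by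
    refine norm_prod_le ?_ ?_ ?_
    · rw [hba]
      linarith
    · rw [zero_mul, sub_zero]
      linarith
    · have n1 : ‖l a • b a‖ = l a := by
        rw [norm_smul, hba, Real.norm_of_nonneg hla0.le, mul_one]
      have n2 : ‖u x • b a‖ ≤ A := by rw [norm_smul, hba, mul_one]; exact hux
      have n3 : ‖(pd (b a) u x - 2 * 0 * u x) • x‖ ≤ A := by
        rw [norm_smul, hx, mul_one, mul_zero, zero_mul, sub_zero]; exact hva
      calc _ ≤ ‖l a • b a‖ + (‖u x • b a‖ + ‖(pd (b a) u x - 2 * 0 * u x) • x‖) :=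
            (norm_sub_le _ _).trans (add_le_add le_rfl (norm_add_le _ _))
        _ ≤ l a + (A + A) := by rw [n1]; gcongr
        _ ≤ _ := by linarith
  refine eigenvalue_le_of_max m hm (l := l) (y := fun j => ⟪x, b j⟫)
    (v := fun j => pd (b j) u x) (V := fun j => pd (b j) (pd (b j) (pd (b a) (pd (b a) u))) x)
    (W := fun j => ∑ p, pd (b p) u x * pd (b j) (pd (b j) (pd (b p) u)) x)
    (γ := fun j => D (0, 0, b j)) (T := fun i j => pd (b a) (pd (b i) (pd (b j) u)) x)
    hl a hR hμ (by rw [hσ]; exact hgμ) (by rw [hσ]; exact (le_abs_self _).trans (hg0.trans hBR))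
    hN hB hla hbig hNbig (fun i j => pd_third_symm hu _ _ _ hx0) hly hy hva ?_ ?_ ?_ ?_ ?_ ?_
  · intro j
    have := (testFn_conditions b hu hx hdiag a hla0.ne' N hmax j).1
    rw [pd_third_rotate hu (b j) (b a) (b a) hx0] at this
    exact this
  · intro j
    have := (testFn_conditions b hu hx hdiag a hla0.ne' N hmax j).2
    simp only [pd_third_rotate hu (b j) _ (b a) hx0] at this
    exact this
  · -- the first derivative of the right-hand side
    have h := ea.1
    rw [mul_zero, zero_mul, sub_zero] at h
    rw [h, mul_assoc]
    exact hDle' _ hn1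
  · -- the second derivative of the right-hand side
    have h := ea.2
    have e1 : ∑ j, pd (b j) (pd (b j) (pd (b a) (pd (b a) u))) x * es l (m + 1) (univ.erase j) =
        ∑ i, pd (b a) (pd (b a) (pd (b i) (pd (b i) u))) x * es l (m + 1) (univ.erase i) :=
      sum_congr rfl fun i _ => by rw [pd_fourth_symm hu (b i) (b a) hx0]
    rw [e1]
    rw [h]
    have q1 : |fderiv ℝ (fderiv ℝ g) P a₁ a₁| ≤ B * (1 + 2 * A) ^ 2 * l a ^ 2 := by
      refine (hg2 a₁).trans ?_
      have : ‖a₁‖ ^ 2 ≤ ((1 + 2 * A) * l a) ^ 2 := pow_le_pow_left₀ (norm_nonneg _) hn1 2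
      calc B * ‖a₁‖ ^ 2 ≤ B * ((1 + 2 * A) * l a) ^ 2 := mul_le_mul_of_nonneg_left this hB
        _ = _ := by ring
    have haa : pd (b a) (pd (b a) u) x = l a := by simp [hij]
    have e2 : ∑ i, pd (b a) (pd (b a) (pd (b i) u)) x • b i -
        ((2 * (pd (b a) u x - 2 * 0 * u x)) • b a + (pd (b a) (pd (b a) u) x -
          4 * 0 * pd (b a) u x + (8 * 0 ^ 2 - 2 * 1 ^ 2) * u x) • x) =
        ∑ i, pd (b a) (pd (b a) (pd (b i) u)) x • b i +
        -((2 * pd (b a) u x) • b a + (l a - 2 * u x) • x) := by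
      rw [haa]
      module
    have e3 : pd (b a) (pd (b a) u) x - 2 * 0 * pd (b a) u x + (3 * 0 ^ 2 - 1 ^ 2) * u x =
        l a - u x := by rw [haa]; ring
    rw [e2, e3]
    have e4 : ((0, l a - u x, ∑ i, pd (b a) (pd (b a) (pd (b i) u)) x • b i +
        -((2 * pd (b a) u x) • b a + (l a - 2 * u x) • x)) : E × ℝ × E) =
        (0, l a - u x, -((2 * pd (b a) u x) • b a + (l a - 2 * u x) • x)) +
        (0, 0, ∑ i, pd (b a) (pd (b a) (pd (b i) u)) x • b i) := by
      rw [Prod.mk_add_mk, Prod.mk_add_mk, add_zero, add_zero, add_comm (-_)]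
    rw [e4, map_add, hDsum]
    have q2 : |D (0, l a - u x, -((2 * pd (b a) u x) • b a + (l a - 2 * u x) • x))| ≤
        B * ((1 + 4 * A) * l a) := by
      refine hDle' _ (norm_prod_le ?_ ?_ ?_)
      · rw [norm_zero]; positivity
      · rw [abs_le]
        constructor <;> linarith
      · have n1 : ‖(2 * pd (b a) u x) • b a‖ ≤ 2 * A := by
          rw [norm_smul, hba, mul_one, norm_mul, Real.norm_ofNat]
          exact mul_le_mul_of_nonneg_left hva (by norm_num)
        have n2 : ‖(l a - 2 * u x) • x‖ ≤ l a + 2 * A := by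
          rw [norm_smul, hx, mul_one, Real.norm_eq_abs, abs_le]
          constructor <;> linarith
        rw [norm_neg]
        refine (norm_add_le _ _).trans ((add_le_add n1 n2).trans ?_)
        linarith
    have q1' := (abs_le.1 q1).1
    have q2' := (abs_le.1 q2).1
    have q3 : g P ≤ B := (le_abs_self _).trans hg0
    have q4 : l a ≤ l a ^ 2 := le_self_pow₀ hla (by norm_num)
    have q5 : B * ((1 + 4 * A) * l a) ≤ B * (1 + 4 * A) * l a ^ 2 := by
      rw [← mul_assoc]
      exact mul_le_mul_of_nonneg_left q4 (by positivity)
    have q6 : (m + 2) * g P ≤ (m + 2) * B * l a ^ 2 := by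
      have : (m + 2) * g P ≤ (m + 2) * B := mul_le_mul_of_nonneg_left q3 (by positivity)
      refine this.trans (le_mul_of_one_le_right (by positivity) (one_le_pow₀ hla))
    linarith
  · -- the derivative of the right-hand side along the gradient
    have e1 : ∑ j, (∑ p, pd (b p) u x * pd (b j) (pd (b j) (pd (b p) u)) x) *
        es l (m + 1) (univ.erase j) =
        ∑ i, pd w (pd (b i) (pd (b i) u)) x * es l (m + 1) (univ.erase i) := by
      refine sum_congr rfl fun i _ => ?_
      congr 1
      rw [hw, gradB, pd_sum_smul]
      exact sum_congr rfl fun p _ => by rw [pd_third_rotate hu (b p) (b i) (b i) hx0]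
    rw [e1, ew]
    have e4 : ((w, ‖w‖ ^ 2 - u x * u x, ∑ i, (l i * pd (b i) u x) • b i -
        (u x • w + (‖w‖ ^ 2 - 2 * u x * u x) • x)) : E × ℝ × E) =
        (w, ‖w‖ ^ 2 - u x * u x, -(u x • w + (‖w‖ ^ 2 - 2 * u x * u x) • x)) +
        (0, 0, ∑ i, (l i * pd (b i) u x) • b i) := by
      rw [Prod.mk_add_mk, Prod.mk_add_mk, add_zero, add_zero, neg_add_eq_sub]
    rw [e4, map_add, hDsum]
    have hw2 : ‖w‖ ^ 2 ≤ A ^ 2 := pow_le_pow_left₀ (norm_nonneg _) hgrad 2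
    have hu2 : u x * u x ≤ A ^ 2 := by
      rw [← pow_two]
      exact sq_le_sq' hux2.1 hux2.2
    have hu3 : 0 ≤ u x * u x := mul_self_nonneg _
    have hw3 : 0 ≤ ‖w‖ ^ 2 := sq_nonneg _
    have hA2 : 0 ≤ A ^ 2 := sq_nonneg _
    have q2 : |D (w, ‖w‖ ^ 2 - u x * u x, -(u x • w + (‖w‖ ^ 2 - 2 * u x * u x) • x))| ≤
        B * (A + 4 * A ^ 2) := by
      refine hDle' _ (norm_prod_le ?_ ?_ ?_)
      · linarith
      · rw [abs_le]
        constructor <;> linarith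
      · have n1 : ‖u x • w‖ ≤ A ^ 2 := by
          rw [norm_smul, sq]
          exact mul_le_mul hux hgrad (norm_nonneg _) hA
        have n2 : ‖(‖w‖ ^ 2 - 2 * u x * u x) • x‖ ≤ 3 * A ^ 2 := by
          rw [norm_smul, hx, mul_one, Real.norm_eq_abs, abs_le]
          constructor <;> linarith
        rw [norm_neg]
        refine (norm_add_le _ _).trans ((add_le_add n1 n2).trans ?_)
        linarith
    have q3 : (m + 2) * u x * g P ≤ (m + 2) * A * B := by
      have : u x * g P ≤ A * B := by
        refine (le_abs_self _).trans ?_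
        rw [abs_mul]
        exact mul_le_mul hux hg0 (abs_nonneg _) hA
      rw [mul_assoc, mul_assoc]
      exact mul_le_mul_of_nonneg_left this (by positivity)
    linarith [(abs_le.1 q2).1]
  · -- the gradient part of the differential, applied to the point itself
    have : ∑ j, D (0, 0, b j) * ⟪x, b j⟫ = D (0, 0, x) := by
      rw [← hDsum]
      congr 3
      conv_rhs => rw [← b.sum_repr' x]
      exact sum_congr rfl fun i _ => by rw [real_inner_comm]
    rw [this]
    have := hDle' (0, 0, x) (r := 1) (norm_prod_le (by simp) (by simp) hx.le)
    simpa using this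

end LocalEstimate

section GradientHessian

variable {E : Type*} [NormedAddCommGroup E] [InnerProductSpace ℝ E]
variable {ι : Type*} [Fintype ι]

/-! ### Changes of basis and scaling -/

theorem inner_gradient [CompleteSpace E] (f : E → ℝ) (x v : E) :
    ⟪gradient f x, v⟫ = pd v f x := by
  unfold gradient pd
  exact InnerProductSpace.toDual_symm_apply

theorem gradient_eq_gradB [CompleteSpace E] (b : OrthonormalBasis ι ℝ E) (f : E → ℝ) :
    gradient f = gradB b f := by
  ext1 x
  refine ext_inner_right ℝ fun v => ?_
  rw [inner_gradient, inner_gradB]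

theorem gradB_contDiffOn (b : OrthonormalBasis ι ℝ E) {f : E → ℝ}
    (hf : ContDiffOn ℝ ∞ f {0}ᶜ) : ContDiffOn ℝ ∞ (gradB b f) {0}ᶜ := by
  unfold gradB
  exact ContDiffOn.sum fun i _ => (pd_contDiffOn hf (b i)).smul contDiffOn_const

theorem inner_fderiv_gradB (b : OrthonormalBasis ι ℝ E) {f : E → ℝ}
    (hf : ContDiffOn ℝ ∞ f {0}ᶜ) {x : E} (hx : x ≠ 0) (v w : E) :
    ⟪fderiv ℝ (gradB b f) x v, w⟫ = pd v (pd w f) x := by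
  have hd : DifferentiableAt ℝ (gradB b f) x :=
    ((gradB_contDiffOn b hf).contDiffAt (isOpen_compl_singleton.mem_nhds hx)).differentiableAt
      (by simp)
  have h : pd w f = fun y => ⟪gradB b f y, w⟫ := by
    ext y
    rw [inner_gradB]
  rw [h]
  unfold pd
  rw [fderiv_inner_apply ℝ hd (differentiableAt_const w)]
  simp

theorem pd_mul {f g : E → ℝ} (hf : ContDiffOn ℝ ∞ f {0}ᶜ) (hg : ContDiffOn ℝ ∞ g {0}ᶜ) (v : E)
    {x : E} (hx : x ≠ 0) : pd v (fun y => f y * g y) x = f x * pd v g x + pd v f x * g x := by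
  unfold pd
  rw [fderiv_fun_mul (differentiableAt_of_ne hf hx) (differentiableAt_of_ne hg hx)]
  simp
  ring

theorem pd_add {f g : E → ℝ} (hf : ContDiffOn ℝ ∞ f {0}ᶜ) (hg : ContDiffOn ℝ ∞ g {0}ᶜ) (v : E)
    {x : E} (hx : x ≠ 0) : pd v (fun y => f y + g y) x = pd v f x + pd v g x := by
  unfold pd
  rw [fderiv_fun_add (differentiableAt_of_ne hf hx) (differentiableAt_of_ne hg hx)]
  simp

theorem minorSum_smul [DecidableEq ι] (k : ℕ) (c : ℝ) (A : Matrix ι ι ℝ) :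
    minorSum k (c • A) = c ^ k * minorSum k A := by
  unfold minorSum
  rw [mul_sum]
  refine sum_congr rfl fun s hs => ?_
  rw [← (mem_powersetCard.1 hs).2, Matrix.submatrix_smul, Pi.smul_apply, Pi.smul_apply,
    Matrix.det_smul, Fintype.card_coe]

theorem hessB_smul [DecidableEq ι] (b : OrthonormalBasis ι ℝ E) {u : E → ℝ}
    (hu : ContDiffOn ℝ ∞ u {0}ᶜ)
    (hhom : ∀ r : ℝ, 0 < r → ∀ y, y ≠ 0 → u (r • y) = r * u y) {r : ℝ} (hr : 0 < r) {y : E}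
    (hy : y ≠ 0) : hessB b u (r • y) = r⁻¹ • hessB b u y := by
  ext i j
  simp [hessB, pd_pd_smul_of_homogeneous hu hhom _ _ hr hy]

theorem gradB_smul (b : OrthonormalBasis ι ℝ E) {u : E → ℝ} (hu : ContDiffOn ℝ ∞ u {0}ᶜ)
    (hhom : ∀ r : ℝ, 0 < r → ∀ y, y ≠ 0 → u (r • y) = r * u y) {r : ℝ} (hr : 0 < r) {y : E}
    (hy : y ≠ 0) : gradB b u (r • y) = gradB b u y := by
  simp [gradB, pd_smul_of_homogeneous hu hhom _ hr hy]

end GradientHessian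

section Sphere

variable {n : ℕ}

/-! ### The homogeneous extension of a function on the sphere -/

theorem norm_sph (x : Sph n) : ‖(x : Euc n)‖ = 1 := mem_sphere_zero_iff_norm.1 x.2

theorem sph_ne_zero (x : Sph n) : (x : Euc n) ≠ 0 := by
  intro h
  have := norm_sph x
  rw [h, norm_zero] at this
  exact zero_ne_one this

theorem retract_coe_of_ne {y : Euc n} (hy : y ≠ 0) : (retract y : Euc n) = ‖y‖⁻¹ • y := by
  simp [retract, hy]

theorem norm_smul_retract {y : Euc n} (hy : y ≠ 0) : y = ‖y‖ • (retract y : Euc n) := by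
  rw [retract_coe_of_ne hy, smul_smul, mul_inv_cancel₀ (norm_ne_zero_iff.2 hy), one_smul]

theorem retract_smul {r : ℝ} (hr : 0 < r) {y : Euc n} (hy : y ≠ 0) :
    retract (r • y) = retract y := by
  apply Subtype.ext
  rw [retract_coe_of_ne hy, retract_coe_of_ne (smul_ne_zero hr.ne' hy), norm_smul,
    Real.norm_of_nonneg hr.le, smul_smul]
  congr 1
  field_simp

/-- The retraction is smooth as a map from the open submanifold `ℝⁿ⁺¹ ∖ {0}` to the sphere. -/
theorem radialExt_contDiffOn {h : Sph n → ℝ} (hh : ContMDiff (𝓡 n) 𝓘(ℝ, ℝ) ∞ h) :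
    ContDiffOn ℝ ∞ (radialExt h) {0}ᶜ := by
  have : Fact (Module.finrank ℝ (Euc n) = n + 1) := ⟨by simp⟩
  let U : TopologicalSpace.Opens (Euc n) := ⟨{0}ᶜ, isOpen_compl_singleton⟩
  have h1 : ContMDiff 𝓘(ℝ, Euc n) 𝓘(ℝ, Euc n) ∞ (fun y : U => ‖(y : Euc n)‖⁻¹ • (y : Euc n)) := by
    intro y
    have hy : (y : Euc n) ≠ 0 := y.2
    have : ContDiffAt ℝ ∞ (fun z : Euc n => ‖z‖⁻¹ • z) y :=
      ((contDiffAt_norm ℝ hy).inv (norm_ne_zero_iff.2 hy)).smul contDiffAt_id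
    exact (contMDiffAt_subtype_iff (f := fun z : Euc n => ‖z‖⁻¹ • z)).2 this.contMDiffAt
  have hmem : ∀ y : U, ‖(y : Euc n)‖⁻¹ • (y : Euc n) ∈ Metric.sphere (0 : Euc n) 1 := by
    intro y
    have hy : (y : Euc n) ≠ 0 := y.2
    rw [mem_sphere_zero_iff_norm, norm_smul, norm_inv, norm_norm,
      inv_mul_cancel₀ (norm_ne_zero_iff.mpr hy)]
  have h2 := hh.comp (ContMDiff.codRestrict_sphere (n := n) h1 hmem)
  intro y hy
  have h3 : ContMDiffAt 𝓘(ℝ, Euc n) 𝓘(ℝ, ℝ) ∞ (fun z : U => radialExt h z) ⟨y, hy⟩ := by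
    have e : (fun z : U => radialExt h z) = h ∘ Set.codRestrict _ _ hmem := by
      ext z
      have hz : (z : Euc n) ≠ 0 := z.2
      simp only [radialExt, Function.comp_apply]
      congr 1
      apply Subtype.ext
      rw [retract_coe_of_ne hz]
      rfl
    rw [e]
    exact h2 _
  exact (contMDiffAt_iff_contDiffAt.1 (contMDiffAt_subtype_iff.1 h3)).contDiffWithinAt

/-- The extension of `h` to a positively homogeneous function of degree one; for the support
function `h` of a convex body this is the support function on the whole space. -/
def homExt (h : Sph n → ℝ) (y : Euc n) : ℝ := ‖y‖ * radialExt h y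

variable {h : Sph n → ℝ}

theorem homExt_contDiffOn (hh : ContMDiff (𝓡 n) 𝓘(ℝ, ℝ) ∞ h) :
    ContDiffOn ℝ ∞ (homExt h) {0}ᶜ :=
  contDiffOn_norm_compl_zero.mul (radialExt_contDiffOn hh)

theorem radialExt_smul (h : Sph n → ℝ) {r : ℝ} (hr : 0 < r) {y : Euc n} (hy : y ≠ 0) :
    radialExt h (r • y) = radialExt h y := by
  simp only [radialExt, retract_smul hr hy]

theorem homExt_smul (h : Sph n → ℝ) (r : ℝ) (hr : 0 < r) (y : Euc n) (hy : y ≠ 0) :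
    homExt h (r • y) = r * homExt h y := by
  simp only [homExt, radialExt_smul h hr hy, norm_smul, Real.norm_of_nonneg hr.le]
  ring

theorem radialExt_coe (h : Sph n → ℝ) (x : Sph n) : radialExt h (x : Euc n) = h x := by
  simp only [radialExt, retract_coe]

theorem homExt_coe (h : Sph n → ℝ) (x : Sph n) : homExt h (x : Euc n) = h x := by
  rw [homExt, norm_sph, one_mul, radialExt_coe]

theorem pd_homExt (hh : ContMDiff (𝓡 n) 𝓘(ℝ, ℝ) ∞ h) (w : Euc n) {y : Euc n} (hy : y ≠ 0) :
    pd w (homExt h) y = ‖y‖ * pd w (radialExt h) y +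
      pd w (fun y => ‖y‖) y * radialExt h y :=
  pd_mul contDiffOn_norm_compl_zero (radialExt_contDiffOn hh) w hy

theorem pd_self_radialExt (hh : ContMDiff (𝓡 n) 𝓘(ℝ, ℝ) ∞ h) (x : Sph n) :
    pd (x : Euc n) (radialExt h) x = 0 :=
  pd_radial (radialExt_contDiffOn hh) (sph_ne_zero x) (c := h x) fun r hr => by
    rw [radialExt_smul h hr (sph_ne_zero x), radialExt_coe]; ring

theorem mem_tan_iff (x : Sph n) (v : Euc n) : v ∈ Tan x ↔ ⟪(x : Euc n), v⟫ = 0 :=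
  Submodule.mem_orthogonal_singleton_iff_inner_right

theorem coe_sphGrad (hh : ContMDiff (𝓡 n) 𝓘(ℝ, ℝ) ∞ h) (x : Sph n) :
    (sphGrad h x : Euc n) = gradient (radialExt h) x := by
  have hmem : gradient (radialExt h) (x : Euc n) ∈ Tan x := by
    rw [mem_tan_iff, real_inner_comm, inner_gradient, pd_self_radialExt hh]
  exact congrArg Subtype.val
    ((Tan x).orthogonalProjectionOnto_mem_subspace_eq_self ⟨_, hmem⟩)

/-- On the sphere, the gradient of the homogeneous extension has tangential part `∇h` and radial
part `h`. -/
theorem gradB_homExt {ι : Type*} [Fintype ι] (b : OrthonormalBasis ι ℝ (Euc n))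
    (hh : ContMDiff (𝓡 n) 𝓘(ℝ, ℝ) ∞ h) (x : Sph n) :
    gradB b (homExt h) (x : Euc n) = (sphGrad h x : Euc n) + h x • (x : Euc n) := by
  refine ext_inner_right ℝ fun w => ?_
  rw [inner_gradB, inner_add_left, coe_sphGrad hh, inner_gradient, real_inner_smul_left,
    pd_homExt hh w (sph_ne_zero x), pd_norm w (sph_ne_zero x), norm_sph, radialExt_coe]
  ring

/-- On tangent vectors the Hessian of the homogeneous extension is `∇²h + h I`. -/
theorem inner_radiiMap (hh : ContMDiff (𝓡 n) 𝓘(ℝ, ℝ) ∞ h) (x : Sph n) (v w : Tan x) :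
    ⟪radiiMap h x v, w⟫ = pd (v : Euc n) (pd (w : Euc n) (homExt h)) x := by
  have hx0 := sph_ne_zero x
  have hr := radialExt_contDiffOn hh
  have hn := contDiffOn_norm_compl_zero (E := Euc n)
  have h1 : ⟪radiiMap h x v, w⟫ =
      pd (v : Euc n) (pd (w : Euc n) (radialExt h)) x + h x * ⟪(v : Euc n), (w : Euc n)⟫ := by
    have e : radiiMap h x v = (Tan x).orthogonalProjectionOnto
        (fderiv ℝ (gradient (radialExt h)) (x : Euc n) (v : Euc n)) + h x • v := rfl
    rw [e, inner_add_left, real_inner_smul_left,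
      Submodule.inner_orthogonalProjectionOnto_eq_of_mem_right, Submodule.coe_inner,
      gradient_eq_gradB (EuclideanSpace.basisFun (Fin (n + 1)) ℝ), inner_fderiv_gradB _ hr hx0]
  have hv : ⟪(x : Euc n), (v : Euc n)⟫ = 0 := (mem_tan_iff x _).1 v.2
  have hw : ⟪(x : Euc n), (w : Euc n)⟫ = 0 := (mem_tan_iff x _).1 w.2
  rw [h1, pd_congr (fun y hy => pd_homExt hh (w : Euc n) hy) (v : Euc n) hx0,
    pd_add (hn.mul (pd_contDiffOn hr _)) ((pd_contDiffOn hn _).mul hr) _ hx0,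
    pd_mul hn (pd_contDiffOn hr _) _ hx0, pd_mul (pd_contDiffOn hn _) hr _ hx0,
    pd_pd_norm _ _ (norm_sph x), pd_norm _ hx0, pd_norm _ hx0, hv, hw, norm_sph, radialExt_coe]
  ring

/-- The Hessian of the homogeneous extension, as an endomorphism of the whole space: the
derivative of the gradient. -/
def homHess (h : Sph n → ℝ) (x : Euc n) : Euc n →ₗ[ℝ] Euc n :=
  (fderiv ℝ (gradB (EuclideanSpace.basisFun (Fin (n + 1)) ℝ) (homExt h)) x : Euc n →L[ℝ] Euc n)

theorem inner_homHess (hh : ContMDiff (𝓡 n) 𝓘(ℝ, ℝ) ∞ h) {x : Euc n} (hx : x ≠ 0)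
    (v w : Euc n) : ⟪homHess h x v, w⟫ = pd v (pd w (homExt h)) x :=
  inner_fderiv_gradB _ (homExt_contDiffOn hh) hx v w

theorem homHess_isSymmetric (hh : ContMDiff (𝓡 n) 𝓘(ℝ, ℝ) ∞ h) {x : Euc n} (hx : x ≠ 0) :
    (homHess h x).IsSymmetric := by
  intro v w
  rw [inner_homHess hh hx, real_inner_comm, inner_homHess hh hx,
    pd_comm (homExt_contDiffOn hh) v w hx]

theorem homHess_self (hh : ContMDiff (𝓡 n) 𝓘(ℝ, ℝ) ∞ h) {x : Euc n} (hx : x ≠ 0) :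
    homHess h x x = 0 := by
  refine ext_inner_right ℝ fun w => ?_
  rw [inner_homHess hh hx, pd_self_pd_of_homogeneous (homExt_contDiffOn hh) (homExt_smul h) w hx,
    inner_zero_left]

theorem coe_radiiMap (hh : ContMDiff (𝓡 n) 𝓘(ℝ, ℝ) ∞ h) (x : Sph n) (v : Tan x) :
    (radiiMap h x v : Euc n) = homHess h x v := by
  have hx0 := sph_ne_zero x
  have hmem : homHess h x v ∈ Tan x := by
    rw [mem_tan_iff, real_inner_comm, homHess_isSymmetric hh hx0, homHess_self hh hx0,
      inner_zero_right]
  have : radiiMap h x v = ⟨homHess h x v, hmem⟩ := by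
    refine ext_inner_right ℝ fun w => ?_
    rw [inner_radiiMap hh, Submodule.coe_inner, inner_homHess hh hx0]
  rw [this]

theorem radiiMap_isSymmetric (hh : ContMDiff (𝓡 n) 𝓘(ℝ, ℝ) ∞ h) (x : Sph n) :
    (radiiMap h x).IsSymmetric := by
  intro v w
  rw [inner_radiiMap hh, real_inner_comm, inner_radiiMap hh,
    pd_comm (homExt_contDiffOn hh) _ _ (sph_ne_zero x)]

theorem finrank_tan (x : Sph n) : Module.finrank ℝ (Tan x) = n := by
  have : Fact (Module.finrank ℝ (Euc n) = n + 1) := ⟨by simp⟩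
  exact Submodule.finrank_orthogonal_span_singleton (sph_ne_zero x)

open Polynomial in
/-- The Hessian of the homogeneous extension has one more eigenvalue than `∇²h + h I`, namely `0`
in the radial direction. -/
theorem charpoly_homHess (hh : ContMDiff (𝓡 n) 𝓘(ℝ, ℝ) ∞ h) (x : Sph n) :
    (homHess h x).charpoly = X * (radiiMap h x).charpoly := by
  have hx0 := sph_ne_zero x
  have hc : IsCompl (ℝ ∙ (x : Euc n)) (Tan x) :=
    Submodule.isCompl_orthogonal _
  set e := Submodule.prodEquivOfIsCompl _ _ hc with he
  have hconj : homHess h x = e.conj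
      ((0 : (ℝ ∙ (x : Euc n)) →ₗ[ℝ] (ℝ ∙ (x : Euc n))).prodMap (radiiMap h x)) := by
    refine LinearMap.ext fun y => ?_
    obtain ⟨⟨s, t⟩, rfl⟩ := e.surjective y
    rw [LinearEquiv.conj_apply_apply, LinearEquiv.symm_apply_apply, LinearMap.prodMap_apply]
    simp only [he, Submodule.coe_prodEquivOfIsCompl', LinearMap.zero_apply, Submodule.coe_zero,
      zero_add, map_add]
    rw [coe_radiiMap hh]
    obtain ⟨c, hc⟩ := Submodule.mem_span_singleton.1 s.2
    rw [← hc, map_smul, homHess_self hh hx0, smul_zero, zero_add]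
  rw [hconj, LinearEquiv.charpoly_conj, LinearMap.charpoly_prodMap]
  congr 1
  rw [LinearMap.charpoly_zero, finrank_span_singleton hx0, pow_one]

/-- `σ_k(∇²h + h I)` is the sum of the principal minors of the Hessian of the homogeneous
extension, in any orthonormal basis of the ambient space. -/
theorem sigma_radiiMap {k : ℕ} (hk : k ≤ n) (hh : ContMDiff (𝓡 n) 𝓘(ℝ, ℝ) ∞ h) (x : Sph n)
    {ι : Type*} [Fintype ι] [DecidableEq ι] (b : OrthonormalBasis ι ℝ (Euc n)) :
    sigma k (radiiMap h x) = minorSum k (hessB b (homExt h) x) := by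
  have hx0 := sph_ne_zero x
  have hcard : Fintype.card ι = n + 1 := by
    rw [← Module.finrank_eq_card_basis b.toBasis]
    simp
  have hmat : LinearMap.toMatrix b.toBasis b.toBasis (homHess h x) = hessB b (homExt h) x := by
    ext i j
    rw [LinearMap.toMatrix_apply, OrthonormalBasis.coe_toBasis,
      OrthonormalBasis.coe_toBasis_repr_apply,
      OrthonormalBasis.repr_apply_apply, real_inner_comm, inner_homHess hh hx0]
    exact pd_comm (homExt_contDiffOn hh) _ _ hx0
  have h1 := Matrix.charpoly_coeff_eq_sum_minors (hessB b (homExt h) (x : Euc n)) k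
    (by rw [hcard]; omega)
  rw [← hmat, LinearMap.charpoly_toMatrix, charpoly_homHess hh, hcard,
    show n + 1 - k = (n - k) + 1 by omega, Polynomial.coeff_X_mul] at h1
  have hdeg : (radiiMap h x).charpoly.natDegree = n := by
    rw [LinearMap.charpoly_natDegree, finrank_tan]
  have h2 := Polynomial.coeff_eq_esymm_roots_of_splits (radiiMap_isSymmetric hh x).splits_charpoly
    (k := n - k) (by rw [hdeg]; omega)
  rw [hdeg, (LinearMap.charpoly_monic _).leadingCoeff, one_mul,
    show n - (n - k) = k by omega, h1, hmat] at h2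
  have h3 : ((-1 : ℝ) ^ k) ≠ 0 := by positivity
  exact (mul_left_cancel₀ h3 h2).symm

end Sphere

section Estimate

variable {n : ℕ} {h : Sph n → ℝ}

/-! ### The estimate on the sphere -/

theorem eqPoint_homExt {ι : Type*} [Fintype ι] (b : OrthonormalBasis ι ℝ (Euc n))
    (hh : ContMDiff (𝓡 n) 𝓘(ℝ, ℝ) ∞ h) (x : Sph n) :
    eqPoint b (homExt h) x = ((x : Euc n), h x, (sphGrad h x : Euc n)) := by
  simp [eqPoint, homExt_coe, gradB_homExt b hh]

theorem bundleExt_eqPoint {ι : Type*} [Fintype ι] (b : OrthonormalBasis ι ℝ (Euc n))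
    (hh : ContMDiff (𝓡 n) 𝓘(ℝ, ℝ) ∞ h) (f : (x : Sph n) → ℝ → Tan x → ℝ) {y : Euc n}
    (hy : y ≠ 0) :
    bundleExt f (eqPoint b (homExt h) y) =
      f (retract y) (h (retract y)) (sphGrad h (retract y)) := by
  have hn := norm_pos_iff.2 hy
  have e1 : (‖y‖ ^ 1)⁻¹ * homExt h y = h (retract y) := by
    rw [homExt, pow_one, inv_mul_cancel_left₀ hn.ne', radialExt]
  have e2 : gradB b (homExt h) y = (sphGrad h (retract y) : Euc n) +
      h (retract y) • (retract y : Euc n) := by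
    conv_lhs => rw [norm_smul_retract hy]
    rw [gradB_smul b (homExt_contDiffOn hh) (homExt_smul h) hn (sph_ne_zero _),
      gradB_homExt b hh]
  have e3 : ((‖y‖ ^ 2)⁻¹ * homExt h y) • y = h (retract y) • (retract y : Euc n) := by
    rw [retract_coe_of_ne hy, smul_smul, homExt, radialExt]
    congr 1
    field_simp
  have e4 : eqPoint b (homExt h) y = (y, h (retract y), (sphGrad h (retract y) : Euc n)) := by
    unfold eqPoint
    rw [e1, e2, e3, add_sub_cancel_right]
  rw [e4]
  simp only [bundleExt]
  rw [Submodule.orthogonalProjectionOnto_mem_subspace_eq_self]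

/-- The equation on the sphere, extended by homogeneity to the punctured space. -/
theorem minorSum_hessB_homExt {k : ℕ} (hk : k ≤ n) (hh : ContMDiff (𝓡 n) 𝓘(ℝ, ℝ) ∞ h)
    {f : (x : Sph n) → ℝ → Tan x → ℝ}
    (heq : ∀ x, sigma k (radiiMap h x) = f x (h x) (sphGrad h x))
    {ι : Type*} [Fintype ι] [DecidableEq ι] (b : OrthonormalBasis ι ℝ (Euc n)) {y : Euc n}
    (hy : y ≠ 0) :
    minorSum k (hessB b (homExt h) y) = (‖y‖ ^ k)⁻¹ * bundleExt f (eqPoint b (homExt h) y) := by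
  have hn := norm_pos_iff.2 hy
  rw [bundleExt_eqPoint b hh f hy, ← heq, sigma_radiiMap hk hh _ b]
  conv_lhs => rw [norm_smul_retract hy]
  rw [hessB_smul b (homExt_contDiffOn hh) (homExt_smul h) hn (sph_ne_zero _), minorSum_smul,
    inv_pow]

theorem norm_homHess_sq (hh : ContMDiff (𝓡 n) 𝓘(ℝ, ℝ) ∞ h) {y : Euc n} (hy : y ≠ 0)
    {ι : Type*} [Fintype ι] (b : OrthonormalBasis ι ℝ (Euc n)) (e : Euc n) :
    ‖homHess h y e‖ ^ 2 = ∑ p, pd (b p) (pd e (homExt h)) y ^ 2 := by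
  rw [← b.sum_sq_norm_inner_right]
  refine sum_congr rfl fun p _ => ?_
  rw [Real.norm_eq_abs, sq_abs, real_inner_comm, inner_homHess hh hy,
    pd_comm (homExt_contDiffOn hh) _ _ hy]

theorem homHess_smul_left (hh : ContMDiff (𝓡 n) 𝓘(ℝ, ℝ) ∞ h) {r : ℝ} (hr : 0 < r) {y : Euc n}
    (hy : y ≠ 0) (e : Euc n) : homHess h (r • y) e = r⁻¹ • homHess h y e := by
  refine ext_inner_right ℝ fun w => ?_
  rw [real_inner_smul_left, inner_homHess hh (smul_ne_zero hr.ne' hy), inner_homHess hh hy,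
    pd_pd_smul_of_homogeneous (homExt_contDiffOn hh) (homExt_smul h) _ _ hr hy]

/-- In terms of the Hessian and the gradient on the sphere, the test function is constant
along rays. -/
theorem testFn_homExt (hh : ContMDiff (𝓡 n) 𝓘(ℝ, ℝ) ∞ h) {ι : Type*} [Fintype ι]
    (b : OrthonormalBasis ι ℝ (Euc n)) (N : ℝ) {e y : Euc n} (hy : y ≠ 0)
    (he : homHess h y e ≠ 0) :
    testFn b (homExt h) N e y = 1 / 2 * Real.log (‖homHess h (retract y) e‖ ^ 2 *
      Real.exp (N * ‖gradB b (homExt h) (retract y)‖ ^ 2)) := by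
  have hn := norm_pos_iff.2 hy
  have h1 : homHess h y e = ‖y‖⁻¹ • homHess h (retract y) e := by
    conv_lhs => rw [norm_smul_retract hy]
    exact homHess_smul_left hh hn (sph_ne_zero _) e
  have h2 : gradB b (homExt h) y = gradB b (homExt h) (retract y) := by
    conv_lhs => rw [norm_smul_retract hy]
    exact gradB_smul b (homExt_contDiffOn hh) (homExt_smul h) hn (sph_ne_zero _)
  have h3 : homHess h (retract y) e ≠ 0 := by
    intro h0
    rw [h1, h0, smul_zero] at he
    exact he rfl
  have h4 := norm_pos_iff.2 h3
  unfold testFn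
  rw [← norm_homHess_sq hh hy, ← norm_gradB_sq, h2, h1, norm_smul, norm_inv, norm_norm, mul_pow,
    Real.log_mul (by positivity) (by positivity), Real.log_mul (by positivity) (by positivity),
    Real.log_exp, Real.log_pow, Real.log_inv]
  push_cast
  ring

/-- Convexity makes all eigenvalues nonnegative: an eigenvector with a nonzero eigenvalue is
tangential. -/
theorem homHess_nonneg (hh : ContMDiff (𝓡 n) 𝓘(ℝ, ℝ) ∞ h) (hconv : SphConvex h) (x : Sph n)
    {v : Euc n} {c : ℝ} (hv : ‖v‖ = 1) (hc : homHess h x v = c • v) : 0 ≤ c := by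
  by_cases h0 : c = 0
  · exact h0.ge
  have hx0 := sph_ne_zero x
  have hmem : v ∈ Tan x := by
    have := homHess_isSymmetric hh hx0 (x : Euc n) v
    rw [homHess_self hh hx0, inner_zero_left, hc, real_inner_smul_right] at this
    rw [mem_tan_iff]
    exact (mul_eq_zero.1 this.symm).resolve_left h0
  have h1 := hconv x ⟨v, hmem⟩
  rw [Submodule.coe_inner, coe_radiiMap hh] at h1
  simp only at h1
  rw [hc, real_inner_smul_left, real_inner_self_eq_norm_sq, hv] at h1
  linarith

/-- The Hessian of the homogeneous extension together with the gradient term of the test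
function has a maximum over all points and directions, and there it is controlled by an
eigenvalue of the Hessian. -/
theorem exists_max_eigenvector (hh : ContMDiff (𝓡 n) 𝓘(ℝ, ℝ) ∞ h) (N : ℝ) :
    ∃ (x₀ : Sph n) (b : OrthonormalBasis (Fin (n + 1)) ℝ (Euc n)) (l : Fin (n + 1) → ℝ)
      (a : Fin (n + 1)), (∀ i, homHess h x₀ (b i) = l i • b i) ∧
      ∀ (x : Sph n) (e : Euc n), ‖e‖ = 1 →
        ‖homHess h x e‖ ^ 2 * Real.exp (N * ‖gradB b (homExt h) x‖ ^ 2) ≤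
          l a ^ 2 * Real.exp (N * ‖gradB b (homExt h) x₀‖ ^ 2) := by
  let b₀ := EuclideanSpace.basisFun (Fin (n + 1)) ℝ
  have hgrad := gradB_contDiffOn b₀ (homExt_contDiffOn hh)
  have hc1 : Continuous fun x : Sph n => gradB b₀ (homExt h) x :=
    hgrad.continuousOn.comp_continuous continuous_subtype_val fun x => sph_ne_zero x
  have hc2 : Continuous fun x : Sph n => fderiv ℝ (gradB b₀ (homExt h)) (x : Euc n) :=
    (hgrad.continuousOn_fderiv_of_isOpen isOpen_compl_singleton (by simp)).comp_continuous
      continuous_subtype_val fun x => sph_ne_zero x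
  have hc3 : Continuous fun q : Sph n × Sph n =>
      ‖homHess h (q.1 : Euc n) (q.2 : Euc n)‖ ^ 2 *
        Real.exp (N * ‖gradB b₀ (homExt h) (q.1 : Euc n)‖ ^ 2) := by
    have : Continuous fun q : Sph n × Sph n =>
        fderiv ℝ (gradB b₀ (homExt h)) (q.1 : Euc n) (q.2 : Euc n) :=
      (hc2.comp continuous_fst).clm_apply (continuous_subtype_val.comp continuous_snd)
    have h2 := hc1.comp (continuous_fst (X := Sph n) (Y := Sph n))
    exact (this.norm.pow 2).mul (Real.continuous_exp.comp (continuous_const.mul (h2.norm.pow 2)))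
  have hne : (Set.univ : Set (Sph n × Sph n)).Nonempty := ⟨(retract 0, retract 0), trivial⟩
  obtain ⟨⟨x₀, e₀⟩, -, hmax⟩ := isCompact_univ.exists_isMaxOn hne hc3.continuousOn
  have hsym := homHess_isSymmetric hh (sph_ne_zero x₀)
  have hfin : Module.finrank ℝ (Euc n) = n + 1 := by simp
  obtain ⟨b, l, heig⟩ : ∃ (b : OrthonormalBasis (Fin (n + 1)) ℝ (Euc n)) (l : Fin (n + 1) → ℝ),
      ∀ i, homHess h x₀ (b i) = l i • b i :=
    ⟨_, _, fun i => hsym.apply_eigenvectorBasis hfin i⟩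
  obtain ⟨a, -, ha⟩ := exists_max_image (univ : Finset (Fin (n + 1))) (fun i => l i ^ 2)
    ⟨0, mem_univ _⟩
  refine ⟨x₀, b, l, a, heig, fun x e he => ?_⟩
  have hgg : ∀ y, gradB b (homExt h) y = gradB b₀ (homExt h) y := fun y => by
    rw [← gradient_eq_gradB, ← gradient_eq_gradB]
  have h1 : ‖homHess h x e‖ ^ 2 * Real.exp (N * ‖gradB b₀ (homExt h) x‖ ^ 2) ≤
      ‖homHess h x₀ e₀‖ ^ 2 * Real.exp (N * ‖gradB b₀ (homExt h) x₀‖ ^ 2) :=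
    isMaxOn_iff.1 hmax (x, (⟨e, mem_sphere_zero_iff_norm.2 he⟩ : Sph n)) (Set.mem_univ _)
  rw [hgg, hgg]
  refine h1.trans (mul_le_mul_of_nonneg_right ?_ (Real.exp_pos _).le)
  rw [← b.sum_sq_norm_inner_right]
  calc ∑ i, ‖⟪b i, homHess h x₀ e₀⟫‖ ^ 2 = ∑ i, l i ^ 2 * ‖⟪b i, (e₀ : Euc n)⟫‖ ^ 2 := by
        refine sum_congr rfl fun i _ => ?_
        rw [← hsym, heig, real_inner_smul_left, norm_mul, mul_pow, Real.norm_eq_abs, sq_abs]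
    _ ≤ ∑ i, l a ^ 2 * ‖⟪b i, (e₀ : Euc n)⟫‖ ^ 2 :=
        sum_le_sum fun i hi => mul_le_mul_of_nonneg_right (ha i hi) (sq_nonneg _)
    _ = l a ^ 2 := by
        rw [← mul_sum, b.sum_sq_norm_inner_right, norm_sph, one_pow, mul_one]

/-- The bound for the Hessian of the homogeneous extension. The first two summands of the constant
cover the cases in which the largest eigenvalue at the maximum is too small for
`eigenvalue_le_of_isLocalMax`. -/
theorem norm_homHess_le (j : ℕ) (hj : j + 2 < n) {m A μ B N : ℝ} (hm : 0 < m) (hμ : 0 < μ)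
    (hA : 0 ≤ A) (hB : 0 ≤ B) (hN : 1 ≤ N)
    (hNbig : (B * (1 + 2 * A) ^ 2 + B * (1 + 4 * A) + (j + 2) * B) + B +
      (B * (1 + 2 * A)) ^ 2 / μ + A ^ 2 * (1 + B) + 1 ≤ N * μ / 4)
    {f : (x : Sph n) → ℝ → Tan x → ℝ} (hh : ContMDiff (𝓡 n) 𝓘(ℝ, ℝ) ∞ h) (hf : IsC2 f)
    (hmh : ∀ x, m ≤ h x) (hconv : SphConvex h)
    (heq : ∀ x, sigma (j + 2) (radiiMap h x) = f x (h x) (sphGrad h x))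
    (hAh : ∀ x, |h x| + ‖sphGrad h x‖ ≤ A) (hμf : ∀ x, μ ≤ f x (h x) (sphGrad h x))
    (hBf : C2BoundAlong f h B) (x : Sph n) {e : Euc n} (he : ‖e‖ = 1) :
    ‖homHess h x e‖ ≤ (1 + N ^ 2 * (18 * (n + 1) * (2 ^ (n + 1) * (1 + B))) +
      N * ((j + 2) * A * B + B * (A + 4 * A ^ 2))) * Real.exp (N * A ^ 2) := by
  obtain ⟨x₀, b, l, a, heig, hmax⟩ := exists_max_eigenvector hh N
  have hx0 := sph_ne_zero x₀
  have hu := homExt_contDiffOn hh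
  have hgradA : ∀ x : Sph n, ‖gradB b (homExt h) x‖ ≤ A := fun x => by
    rw [gradB_homExt b hh]
    refine (norm_add_le _ _).trans ?_
    rw [norm_smul, norm_sph, mul_one, Real.norm_eq_abs, add_comm]
    exact hAh x
  have hl : ∀ i, 0 ≤ l i := fun i => homHess_nonneg hh hconv x₀ (b.norm_eq_one i) (heig i)
  set Λ := 1 + N ^ 2 * (18 * (n + 1) * (2 ^ (n + 1) * (1 + B))) +
      N * ((j + 2) * A * B + B * (A + 4 * A ^ 2)) with hΛ
  have hΛ1 : 0 ≤ N ^ 2 * (18 * (n + 1) * (2 ^ (n + 1) * (1 + B))) := by positivity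
  have hΛ2 : 0 ≤ N * ((j + 2) * A * B + B * (A + 4 * A ^ 2)) := by positivity
  have hla : l a ≤ Λ := by
    rcases le_total (l a) 1 with h1 | h1
    · linarith
    rcases le_total (l a) (N ^ 2 * (18 * (n + 1) * (2 ^ (n + 1) * (1 + B)))) with h2 | h2
    · linarith
    have hP := eqPoint_homExt b hh x₀
    have hb := hBf x₀
    rw [← hP] at hb
    have hval : bundleExt f (eqPoint b (homExt h) x₀) = f x₀ (h x₀) (sphGrad h x₀) := by
      rw [hP, bundleExt_coe]
    have hdiag : hessB b (homExt h) (x₀ : Euc n) = Matrix.diagonal l := by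
      ext p q
      rw [hessB, Matrix.of_apply, ← inner_homHess hh hx0, heig, real_inner_smul_left,
        OrthonormalBasis.inner_eq_ite, Matrix.diagonal_apply]
      split_ifs <;> simp
    have hlocal : IsLocalMax (testFn b (homExt h) N (b a)) (x₀ : Euc n) := by
      have hne : homHess h x₀ (b a) ≠ 0 := by
        rw [heig]
        exact smul_ne_zero (by linarith) (b.orthonormal.ne_zero a)
      have hcont : ContinuousAt (fun y => homHess h y (b a)) (x₀ : Euc n) := by
        have := ((gradB_contDiffOn (EuclideanSpace.basisFun (Fin (n + 1)) ℝ)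
          hu).continuousOn_fderiv_of_isOpen isOpen_compl_singleton (by simp)).continuousAt
          (isOpen_compl_singleton.mem_nhds hx0)
        exact this.clm_apply continuousAt_const
      -- near `x₀` the Hessian does not annihilate `b a`, so the logarithm is that of a positive
      -- number
      filter_upwards [hcont.eventually_ne hne, isOpen_compl_singleton.mem_nhds hx0] with y hy1 hy0
      rw [testFn_homExt hh b N hy0 hy1, testFn_homExt hh b N hx0 hne, retract_coe]
      have hpos : 0 < ‖homHess h (retract y) (b a)‖ := by
        rw [norm_pos_iff]
        intro h0
        apply hy1
        rw [norm_smul_retract hy0, homHess_smul_left hh (norm_pos_iff.2 hy0) (sph_ne_zero _), h0,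
          smul_zero]
      refine mul_le_mul_of_nonneg_left (Real.log_le_log (by positivity) ?_) (by norm_num)
      refine (hmax (retract y) (b a) (b.norm_eq_one a)).trans_eq ?_
      rw [heig, norm_smul, b.norm_eq_one, mul_one, Real.norm_eq_abs, sq_abs]
    have key := eigenvalue_le_of_isLocalMax j (by rw [Fintype.card_fin]; omega) b hu
      (homExt_smul h) (g := bundleExt f) (fun y hy => minorSum_hessB_homExt hj.le hh heq b hy)
      (norm_sph x₀) (A := A) (B := B) (μ := μ) (R := 1 + B) (N := N) ?_ hA hB ?_ (hgradA x₀)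
      ?_ ?_ ?_ hdiag hl a h1 (by linarith) (by linarith) hμ (by rw [hval]; exact hμf x₀) hN ?_
      hNbig hlocal
    · linarith
    · have hopen : IsOpen {w : Euc n × ℝ × Euc n | w.1 ≠ 0 ∧ 0 < w.2.1} :=
        (isOpen_ne_fun continuous_fst continuous_const).inter
          (isOpen_lt continuous_const (continuous_fst.comp continuous_snd))
      refine hf.contDiffAt (hopen.mem_nhds ?_)
      rw [hP]
      exact ⟨hx0, hm.trans_le (hmh x₀)⟩
    · rw [homExt_coe]
      linarith [hAh x₀, norm_nonneg (sphGrad h x₀)]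
    · have := hb 0 (by norm_num)
      rwa [norm_iteratedFDeriv_zero, Real.norm_eq_abs] at this
    · have := hb 1 (by norm_num)
      rwa [norm_iteratedFDeriv_one] at this
    · intro v
      have h3 := hb 2 le_rfl
      have h4 := (iteratedFDeriv ℝ 2 (bundleExt f) (eqPoint b (homExt h) x₀)).le_opNorm ![v, v]
      rw [iteratedFDeriv_two_apply] at h4
      simp only [Fin.prod_univ_two, Matrix.cons_val_zero, Matrix.cons_val_one, Real.norm_eq_abs]
        at h4
      refine h4.trans ?_
      rw [← sq]
      exact mul_le_mul_of_nonneg_right h3 (sq_nonneg _)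
    · rw [Fintype.card_fin, le_inv_mul_iff₀ (by positivity)]
      push_cast
      exact h2
  have hla0 := hl a
  have h1 := hmax x e he
  have h2 : ‖homHess h x e‖ ^ 2 ≤ (Λ * Real.exp (N * A ^ 2)) ^ 2 := by
    calc ‖homHess h x e‖ ^ 2
        ≤ ‖homHess h x e‖ ^ 2 * Real.exp (N * ‖gradB b (homExt h) x‖ ^ 2) :=
          le_mul_of_one_le_right (sq_nonneg _) (Real.one_le_exp (by positivity))
      _ ≤ l a ^ 2 * Real.exp (N * ‖gradB b (homExt h) x₀‖ ^ 2) := h1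
      _ ≤ Λ ^ 2 * Real.exp (N * A ^ 2) ^ 2 := by
          refine mul_le_mul (pow_le_pow_left₀ hla0 hla 2) ?_ (Real.exp_pos _).le (sq_nonneg _)
          have h3 : Real.exp (N * ‖gradB b (homExt h) x₀‖ ^ 2) ≤ Real.exp (N * A ^ 2) := by
            rw [Real.exp_le_exp]
            exact mul_le_mul_of_nonneg_left (pow_le_pow_left₀ (norm_nonneg _) (hgradA x₀) 2)
              (by linarith)
          refine h3.trans (le_self_pow₀ (Real.one_le_exp (by positivity)) two_ne_zero)
      _ = _ := by ring
  exact le_of_sq_le_sq h2 (by positivity)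

theorem sphLaplacian_add_eq_trace (h : Sph n → ℝ) (x : Sph n) :
    sphLaplacian h x + n * h x = LinearMap.trace ℝ (Tan x) (radiiMap h x) := by
  rw [radiiMap, map_add, map_smul, LinearMap.trace_id, finrank_tan, smul_eq_mul, sphLaplacian]
  ring

theorem trace_radiiMap_le (hh : ContMDiff (𝓡 n) 𝓘(ℝ, ℝ) ∞ h) (x : Sph n) {c : ℝ}
    (hc : ∀ e : Euc n, ‖e‖ = 1 → ‖homHess h x e‖ ≤ c) :
    LinearMap.trace ℝ (Tan x) (radiiMap h x) ≤ n * c := by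
  set b := stdOrthonormalBasis ℝ (Tan x)
  rw [LinearMap.trace_eq_sum_inner _ b]
  calc ∑ i, ⟪b i, radiiMap h x (b i)⟫ ≤ ∑ _i : Fin (Module.finrank ℝ (Tan x)), c := by
        refine sum_le_sum fun i _ => ?_
        have hb : ‖(b i : Euc n)‖ = 1 := b.norm_eq_one i
        rw [Submodule.coe_inner, coe_radiiMap hh]
        refine (real_inner_le_norm _ _).trans ?_
        rw [hb, one_mul]
        exact hc _ hb
    _ = n * c := by rw [sum_const, card_univ, Fintype.card_fin, finrank_tan, nsmul_eq_mul]

theorem sigma_one_radiiMap (hh : ContMDiff (𝓡 n) 𝓘(ℝ, ℝ) ∞ h) (x : Sph n) :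
    sigma 1 (radiiMap h x) = LinearMap.trace ℝ (Tan x) (radiiMap h x) := by
  rw [Module.End.trace_eq_sum_roots_charpoly_of_splits (radiiMap_isSymmetric hh x).splits_charpoly,
    sigma, Multiset.esymm, Multiset.powersetCard_one, Multiset.map_map]
  simp

end Estimate

end SphereHessian

end

open SphereHessian in
theorem theorem3p5 (n k : ℕ) (hk : 1 ≤ k) (hkn : k < n)
    (m A μ B : ℝ) (hm : 0 < m) (hμ : 0 < μ) :
    ∃ C : ℝ, 0 < C ∧
      ∀ (h : Sph n → ℝ) (f : (x : Sph n) → ℝ → Tan x → ℝ),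
        ContMDiff (𝓡 n) 𝓘(ℝ, ℝ) ∞ h →
        IsC2 f →
        (∀ x, m ≤ h x) →
        SphConvex h →
        (∀ x, sigma k (radiiMap h x) = f x (h x) (sphGrad h x)) →
        (∀ x, |h x| + ‖sphGrad h x‖ ≤ A) →
        (∀ x, μ ≤ f x (h x) (sphGrad h x)) →
        C2BoundAlong f h B →
        ∀ x, sphLaplacian h x + n * h x ≤ C := by
  obtain rfl | ⟨j, rfl⟩ : k = 1 ∨ ∃ j, k = j + 2 := by
    rcases k with _ | _ | j
    · omega
    · exact Or.inl rfl
    · exact Or.inr ⟨j, rfl⟩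
  · -- For `k = 1` the equation itself bounds the trace.
    refine ⟨|B| + 1, by positivity, fun h f hh _ _ _ heq _ _ hBf x => ?_⟩
    rw [sphLaplacian_add_eq_trace, ← sigma_one_radiiMap hh, heq]
    have h0 := hBf x 0 (by norm_num)
    rw [norm_iteratedFDeriv_zero, bundleExt_coe, Real.norm_eq_abs] at h0
    linarith [le_abs_self (f x (h x) (sphGrad h x)), le_abs_self B]
  · set K := (|B| * (1 + 2 * |A|) ^ 2 + |B| * (1 + 4 * |A|) + (j + 2) * |B|) + |B| +
      (|B| * (1 + 2 * |A|)) ^ 2 / μ + |A| ^ 2 * (1 + |B|) + 1 with hK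
    have hK0 : 0 ≤ K := by positivity
    set N := 1 + 4 * K / μ with hN
    have hN1 : 1 ≤ N := le_add_of_nonneg_right (by positivity)
    set c := (1 + N ^ 2 * (18 * (n + 1) * (2 ^ (n + 1) * (1 + |B|))) +
      N * ((j + 2) * |A| * |B| + |B| * (|A| + 4 * |A| ^ 2))) * Real.exp (N * |A| ^ 2) with hc
    have hc0 : 0 ≤ c := by positivity
    refine ⟨n * c + 1, by positivity, fun h f hh hf hmh hconv heq hAh hμf hBf x => ?_⟩
    rw [sphLaplacian_add_eq_trace]
    refine (trace_radiiMap_le hh x fun e he => ?_).trans (le_add_of_nonneg_right zero_le_one)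
    refine norm_homHess_le j hkn hm hμ (abs_nonneg A) (abs_nonneg B) hN1 ?_ hh hf hmh hconv heq
      (fun x => (hAh x).trans (le_abs_self A)) hμf
      (fun x i hi => (hBf x i hi).trans (le_abs_self B)) x he
    have : N * μ / 4 = K + μ / 4 := by
      rw [hN]
      field_simp
      ring
    rw [this]
    linarith
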